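/- Setting. Let $n,d,T\ge 1$ be integers, $G,R>0$, $\mathcal X=[0,1]^d$, and let $\mathcal K\subseteq\mathcal X$ be a nonempty closed convex set with $\|\mathbf x\|\le R$ for all $\mathbf x\in\mathcal K$ (Euclidean norm). Fix $\underline{\mathbf x}\in\operatorname{argmin}_{\mathbf x\in\mathcal K}\|\mathbf x\|_\infty$ and put $\nu=\|\underline{\mathbf x}\|_\infty$, $\alpha=(1-\nu)/4$. At each round $t\in[T]$ every learner $i\in[n]$ has a differentiable reward function $f_t^i:\mathcal X\to[0,\infty)$, fixed in advance (oblivious adversary), which is continuous and DR-submodular: $f_t^i(\mathbf x+z\mathbf e_j)-f_t^i(\mathbf x)\ge f_t^i(\mathbf y+z\mathbf e_j)-f_t^i(\mathbf y)$ whenever $\mathbf x\le\mathbf y$ (coordinatewise), $z\ge0$, $j\in[d]$, and the four points lie in $\mathcal X$. A stochastic gradient oracle answers a query $\mathbf x\in\mathcal X$ with $\tilde\nabla f_t^i(\mathbf x)$, where $\mathbb E[\tilde\nabla f_t^i(\mathbf x)\mid\mathbf x]=\nabla f_t^i(\mathbf x)$ and $\|\tilde\nabla f_t^i(\mathbf x)\|\le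 G$. Let $A\in\mathbb R^{n\times n}$ be a symmetric, doubly stochastic, positive semidefinite matrix supported on a graph $\mathcal G=([n],\mathcal E)$ (i.e. $A_{ij}>0$ only if $(i,j)\in\mathcal E$ or $i=j$), with second largest singular value $\sigma_2(A)<1$ (where $\sigma_2(A)=0$ if $n=1$), and let $$\rho=1-\sigma_2(A),\qquad C=\left\lceil\frac{\sqrt2\,\ln\sqrt{14n}}{(\sqrt2-1)\sqrt\rho}\right\rceil,\qquad \theta=\frac1{1+\sqrt{1-\sigma_2(A)^2}},\qquad h=\frac{\sqrt{5CT}\,G}{R}.$$ Algorithm. At every round $t$ each learner $i$ gets $\hat{\mathbf x}_t^i\in\mathcal K$ from AD-FTRL, plays $\mathbf x_t^i=(\hat{\mathbf x}_t^i+\underline{\mathbf x})/2$, samples $z_t^i\in[0,1]$ with density $u\mapsto\frac13(1-\frac u2)^{-3}$, independently of everything else, sets $\tilde\nabla F_t^i=\frac38\tilde\nabla f_t^i\big(\frac{z_t^i}2(\hat{\mathbf x}_t^i-\underline{\mathbf x})+\underline{\mathbf x}\big)$, and passes the loss $\ell_t^i(\mathbf x)=\langle-\tilde\nabla F_t^i,\mathbf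 x\rangle$ to AD-FTRL. The oracles use fresh randomness at every round. AD-FTRL divides the rounds into consecutive blocks $q=1,2,\dots$ of length $C$ (the last one may be incomplete) and uses $\hat{\mathbf x}_t^i=\mathbf x_q^i$ for all rounds $t$ of block $q$; $\mathbf x_1^i$ is the point of $\mathcal K$ of least Euclidean norm and $\mathbf z^i_{1,0}=\mathbf z^i_{1,-1}=\mathbf 0$. In each block it computes $\mathbf z_{q,k+1}^i=(1+\theta)\sum_{j=1}^nA_{ij}\mathbf z_{q,k}^j-\theta\mathbf z_{q,k-1}^i$ for $k=0,\dots,C-1$, one step per round, and at its end, with $\mathbf g_q^i=\sum_{t\in\text{block }q}\nabla\ell_t^i(\mathbf x_q^i)$, it sets $\mathbf x_{q+1}^i=\operatorname{argmin}_{\mathbf x\in\mathcal K}\langle\mathbf z_{q,C}^i,\mathbf x\rangle+h\|\mathbf x\|^2$, $\mathbf z_{q+1,0}^i=\mathbf z_{q,C}^i+\mathbf g_q^i$ and $\mathbf z_{q+1,-1}^i=\mathbf z_{q,C-1}^i+\mathbf g_q^i$. Claim. With $f_t=\sum_{j=1}^nf_t^j$, for every learner $i\in[n]$, $$\mathbb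 E\Big[\alpha\max_{\mathbf x\in\mathcal K}\sum_{t=1}^Tf_t(\mathbf x)-\sum_{t=1}^Tf_t(\mathbf x_t^i)\Big]\le 2nGR\sqrt{5TC}.$$ In particular there is a universal constant $c>0$ such that for $n\ge2$ this expected regret is at most $c\,nGR\,\rho^{-1/4}\sqrt{T\ln n}$. -/

import Mathlib

open MeasureTheory ProbabilityTheory

noncomputable section

/-- `ℝ^d` with the Euclidean norm. -/
abbrev Vec (d : ℕ) : Type := EuclideanSpace ℝ (Fin d)

/-- The feasible set `𝒳 = [0,1]^d`. -/
def unitCube (d : ℕ) : Set (Vec d) := {x | ∀ j, x j ∈ Set.Icc (0 : ℝ) 1}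

/-- The norm `‖x‖_∞` of a vector of `ℝ^d`. -/
def supNorm {d : ℕ} (x : Vec d) : ℝ := ‖WithLp.ofLp x‖

/-- Continuous DR-submodularity of `f` over `𝒳 = [0,1]^d`: increments along a coordinate
direction diminish with respect to the coordinatewise order. -/
structure IsDRSubmodular {d : ℕ} (f : Vec d → ℝ) : Prop where
  continuousOn : ContinuousOn f (unitCube d)
  diminishing : ∀ x ∈ unitCube d, ∀ y ∈ unitCube d, (∀ j, x j ≤ y j) →
    ∀ (j : Fin d) (z : ℝ), 0 ≤ z →
      x + EuclideanSpace.single j z ∈ unitCube d → y + EuclideanSpace.single j z ∈ unitCube d →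
      f (y + EuclideanSpace.single j z) - f y ≤ f (x + EuclideanSpace.single j z) - f x

/-- `o x ξ` is the answer of a stochastic gradient oracle of `f` to the query `x`, where `ξ` is
the internal randomness of the oracle, with law `μ`. The oracle is unbiased and its answers are
bounded by `G`, for all queries in `𝒳 = [0,1]^d`. Gradients are taken relative to `𝒳`, since `f`
only has to make sense there. -/
structure IsStochasticGradient {d : ℕ} {Ξ : Type*} [MeasurableSpace Ξ] (μ : Measure Ξ) (G : ℝ)
    (f : Vec d → ℝ) (o : Vec d → Ξ → Vec d) : Prop where
  measurable : Measurable (fun p : Vec d × Ξ => o p.1 p.2)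
  unbiased : ∀ x ∈ unitCube d, HasGradientWithinAt f (∫ ξ, o x ξ ∂μ) (unitCube d) x
  bounded : ∀ x ∈ unitCube d, ∀ᵐ ξ ∂μ, ‖o x ξ‖ ≤ G

/-- The second largest singular value of a square matrix (`0` for a `1 × 1` matrix); Mathlib
numbers the singular values from `0`, in decreasing order. -/
def sigma₂ {n : ℕ} (A : Matrix (Fin n) (Fin n) ℝ) : ℝ :=
  (Matrix.toEuclideanLin A).singularValues 1

/-- The spectral gap `ρ = 1 - σ₂(A)`. -/
def spectralGap {n : ℕ} (A : Matrix (Fin n) (Fin n) ℝ) : ℝ := 1 - sigma₂ A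

/-- The communication matrices of the network `𝒢`. -/
structure IsCommunicationMatrix {n : ℕ} (𝒢 : SimpleGraph (Fin n))
    (A : Matrix (Fin n) (Fin n) ℝ) : Prop where
  supported : ∀ i j, 0 < A i j → 𝒢.Adj i j ∨ i = j
  symmetric : A.IsSymm
  doublyStochastic : A ∈ doublyStochastic ℝ (Fin n)
  posSemidef : A.PosSemidef
  sigma₂_lt_one : sigma₂ A < 1

/-- The law `𝒵` on `[0,1]`, with density `u ↦ (1 - u/2)^{-3} / 3`. -/
def boostingLaw : Measure ℝ :=
  (volume.restrict (Set.Icc (0 : ℝ) 1)).withDensity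
    (fun u => ENNReal.ofReal (((1 - u / 2) ^ 3)⁻¹ / 3))

/-- A decentralized online convex optimization algorithm for `n` learners in `ℝ^d`: from the
current state every learner gets a decision; then every learner `i` receives its loss function
and the state is updated. -/
structure DOCOAlgorithm (n d : ℕ) where
  State : Type
  start : State
  decision : State → Fin n → Vec d
  update : State → (Fin n → Vec d → ℝ) → State

section Reduction

variable {n d : ℕ} {Ξ : Type*}

/-- The point `(z/2)(x̂ - x̲) + x̲` at which the stochastic gradient is queried. -/
def queryPoint (xlow xhat : Vec d) (z : ℝ) : Vec d := (z / 2) • (xhat - xlow) + xlow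

/-- The state of `D` after `t` rounds of the submodular-to-convex reduction. The oracle of learner
`i` at round `t` is `o t i`, and the randomness of round `t` is `w t = (ξ, z)`, where `ξ` is that
of the oracles and `z i` is the sample of learner `i`. Rounds are numbered from `0`. -/
def reductionState (D : DOCOAlgorithm n d) (xlow : Vec d)
    (o : ℕ → Fin n → Vec d → Ξ → Vec d) (w : ℕ → Ξ × (Fin n → ℝ)) : ℕ → D.State
  | 0 => D.start
  | t + 1 =>
    let s := reductionState D xlow o w t
    -- `∇̃F i` is the stochastic gradient of the boosted function of learner `i`
    let gradF : Fin n → Vec d := fun i =>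
      (3 / 8 : ℝ) • o t i (queryPoint xlow (D.decision s i) ((w t).2 i)) (w t).1
    D.update s (fun i x => inner ℝ (-gradF i) x)

/-- The decision `x_t^i = (x̂_t^i + x̲)/2` played by learner `i` at round `t`. -/
def played (D : DOCOAlgorithm n d) (xlow : Vec d)
    (o : ℕ → Fin n → Vec d → Ξ → Vec d) (w : ℕ → Ξ × (Fin n → ℝ)) (t : ℕ) (i : Fin n) : Vec d :=
  (1 / 2 : ℝ) • (D.decision (reductionState D xlow o w t) i + xlow)

/-- The `α`-regret over `T` rounds, for the global rewards `f_t = ∑_j f_t^j`, of a learner that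
plays `x t` at round `t`. -/
def approxRegret (K : Set (Vec d)) (f : ℕ → Fin n → Vec d → ℝ) (α : ℝ) (T : ℕ)
    (x : ℕ → Vec d) : ℝ :=
  α * sSup ((fun y => ∑ t ∈ Finset.range T, ∑ j, f t j y) '' K)
    - ∑ t ∈ Finset.range T, ∑ j, f t j (x t)

end Reduction

section ADFTRL

variable {n d : ℕ}

open Classical in
/-- A minimizer of `φ` over `K` (`0` if there is none). -/
def argminOn (K : Set (Vec d)) (φ : Vec d → ℝ) : Vec d :=
  if hx : ∃ x ∈ K, IsMinOn φ K x then hx.choose else 0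

/-- The state of AD-FTRL during a block `q`, after `k` rounds of this block. -/
structure ADFTRLState (n d : ℕ) where
  /-- the number `k` of rounds of the block that are already finished -/
  k : ℕ
  /-- the decisions `x_q^i`, which are fixed during the block -/
  x : Fin n → Vec d
  /-- the gossip variables `z_{q,k}^i` -/
  cur : Fin n → Vec d
  /-- the gossip variables `z_{q,k-1}^i` -/
  prev : Fin n → Vec d
  /-- the sums of the local gradients over the finished rounds of the block -/
  acc : Fin n → Vec d

/-- One round of AD-FTRL with communication matrix `A`, block size (and number of gossip steps
per block) `L`, mixing ratio `θ` and regularization parameter `h`. In every round there is one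
accelerated gossip step
`z_{q,k+1}^i = (1+θ) ∑_j A_{ij} z_{q,k}^j - θ z_{q,k-1}^i`. At the end of the block one sets
`z_q^i = z_{q,L}^i`, `x_{q+1}^i = argmin_{x ∈ K} ⟨z_q^i, x⟩ + h ‖x‖²`,
`z_{q+1,0}^i = z_{q,L}^i + g_q^i` and `z_{q+1,-1}^i = z_{q,L-1}^i + g_q^i`, where `g_q^i` is the sum
of the local gradients over the block. -/
def ADFTRLStep (K : Set (Vec d)) (A : Matrix (Fin n) (Fin n) ℝ) (L : ℕ) (θ h : ℝ)
    (s : ADFTRLState n d) (ℓ : Fin n → Vec d → ℝ) : ADFTRLState n d :=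
  let next : Fin n → Vec d := fun i => (1 + θ) • (∑ j, A i j • s.cur j) - θ • s.prev i
  let g : Fin n → Vec d := fun i => s.acc i + gradient (ℓ i) (s.x i)
  if s.k + 1 < L then
    { k := s.k + 1, x := s.x, cur := next, prev := s.cur, acc := g }
  else
    { k := 0
      x := fun i => argminOn K (fun y => inner ℝ (next i) y + h * ‖y‖ ^ 2)
      cur := fun i => next i + g i
      prev := fun i => s.cur i + g i
      acc := fun _ => 0 }

/-- AD-FTRL: accelerated decentralized follow-the-regularized-leader. In the first block all
gossip variables are `0`, and the decision is the point of `K` of least norm. -/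
def ADFTRL (K : Set (Vec d)) (A : Matrix (Fin n) (Fin n) ℝ) (L : ℕ) (θ h : ℝ) :
    DOCOAlgorithm n d where
  State := ADFTRLState n d
  start :=
    { k := 0
      x := fun _ => argminOn K (fun y => ‖y‖)
      cur := fun _ => 0
      prev := fun _ => 0
      acc := fun _ => 0 }
  decision := fun s => s.x
  update := ADFTRLStep K A L θ h

/-- The block size `C = ⌈√2 ln √(14 n) / ((√2 - 1) √ρ)⌉`. -/
def blockSize (A : Matrix (Fin n) (Fin n) ℝ) : ℕ :=
  ⌈√2 * Real.log √(14 * n) / ((√2 - 1) * √(spectralGap A))⌉₊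

/-- The mixing ratio `θ = 1 / (1 + √(1 - σ₂(A)²))`. -/
def mixingRatio (A : Matrix (Fin n) (Fin n) ℝ) : ℝ := 1 / (1 + √(1 - sigma₂ A ^ 2))

end ADFTRL

end

/-! ### Regularized minimizers: stability and be-the-leader -/

section FTRL

variable {E : Type*} [NormedAddCommGroup E] [InnerProductSpace ℝ E]

/-! The proof combines a reduction from DR-submodular to linear rewards with a regret bound for
AD-FTRL on linear losses that holds along every path with bounded gradients.

Reduction. A DR-submodular function is concave along nonnegative directions. At a point `a` with
coordinates at most `m` this gives `(1 - m) f y - 2 f a ≤ ⟨∇f a, y - a⟩`: split `y - a` into the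
parts leading to the join and the meet of `y` and `a`, and use `f (y ∨ a) ≥ (1 - m) f y` and `f (y ∧
a) ≥ 0` (`IsDRSubmodular.gradient_bound`). Averaged over the segment from `xlow` to the midpoint of
`xhat` and `xlow`, with the weights of `boostingLaw`, the lower bound is an exact derivative and
integrates to at least `(1 - ν)/4 * f y - f (midpoint)` (`boosting_bound`). As the state before a
round is independent of the randomness of that round, the same holds in expectation for the sampled
losses (`IsStochasticGradient.integral_sample_le`).

Consensus. In the eigenbasis of `A - 11ᵀ/n`, accelerated gossip is the scalar recursion `x' = τ x -
θ y` with `τ² < 4θ`. The form `‖x‖² - τ⟨x, y⟩ + θ‖y‖²` is then positive definite and each step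
multiplies it by exactly `θ`. A block of `C` steps makes the corresponding norm smaller by a factor
`√(14 n)`, which absorbs the factor `√n` of the gradients injected at block ends. So every learner
minimizes a regularized linear function whose coefficient is within `4CΓ` of the true sum of
averaged gradients, current round included, and its decision is within `2CΓ/h` of the be-the-leader
point (`ADFTRLInvariant.dist_le`).

Regret. Be-the-leader has regret at most `h R²`; replacing it by the learners' decisions and moving
from learner `j` to learner `i` costs a further `4TCΓ²/h` per learner (`adftrlRun_regret`). The
second cost occurs because the loss of `j` controls `f_t^j` only at the point played by `j`, while
the regret of `i` evaluates it at the point played by `i`; `f_t^j` is `G`-Lipschitz. The choice of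
`h` balances the two terms. -/

/-- `p` minimizes the regularized linear function `⟨z, ·⟩ + h ‖·‖²` over `K`. -/
def IsRegMin (K : Set E) (h : ℝ) (z p : E) : Prop :=
  p ∈ K ∧ IsMinOn (fun y => inner ℝ z y + h * ‖y‖ ^ 2) K p

/-- First-order optimality at `p`: otherwise a short move towards `y` would decrease the objective.
-/
theorem IsRegMin.variational {K : Set E} (hK : Convex ℝ K) {h : ℝ} {z p : E}
    (hp : IsRegMin K h z p) {y : E} (hy : y ∈ K) :
    0 ≤ inner ℝ z (y - p) + 2 * h * inner ℝ p (y - p) := by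
  by_contra! hneg
  set b := inner ℝ z (y - p) + 2 * h * inner ℝ p (y - p) with hb
  set c := |h| * ‖y - p‖ ^ 2 with hc
  have hc0 : 0 ≤ c := by positivity
  have key : ∀ s : ℝ, 0 ≤ s → s ≤ 1 → 0 ≤ s * b + s ^ 2 * c := by
    intro s hs0 hs1
    have hmem : p + s • (y - p) ∈ K := hK.add_smul_sub_mem hp.1 hy ⟨hs0, hs1⟩
    have h1 : inner ℝ z p + h * ‖p‖ ^ 2
        ≤ inner ℝ z (p + s • (y - p)) + h * ‖p + s • (y - p)‖ ^ 2 := hp.2 hmem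
    rw [norm_add_sq_real, inner_add_right, inner_smul_right, inner_smul_right, norm_smul,
      mul_pow, Real.norm_eq_abs, sq_abs] at h1
    have h2 : h * ‖y - p‖ ^ 2 ≤ c := mul_le_mul_of_nonneg_right (le_abs_self h) (by positivity)
    have h3 := mul_le_mul_of_nonneg_left h2 (sq_nonneg s)
    rw [hb]
    nlinarith
  -- The minimizer of `s * b + s ^ 2 * c` is `-b / (2 * c)`; `c - b` in place of `c` keeps the step
  -- defined when `c = 0` and at most `1`, and the value stays negative.
  have h4 := key (-b / (2 * (c - b))) (div_nonneg (by linarith) (by linarith))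
    (by rw [div_le_one (by linarith)]; linarith)
  have h5 : -b / (2 * (c - b)) * b + (-b / (2 * (c - b))) ^ 2 * c
      = b ^ 2 * (-2 * (c - b) + c) / (2 * (c - b)) ^ 2 := by
    have : c - b ≠ 0 := by linarith
    field_simp
  rw [h5] at h4
  have h6 : b ^ 2 * (-2 * (c - b) + c) / (2 * (c - b)) ^ 2 < 0 := by
    apply div_neg_of_neg_of_pos
    · exact mul_neg_of_pos_of_neg (sq_pos_of_neg hneg) (by linarith)
    · have : 0 < c - b := by linarith
      positivity
  linarith

/-- Strong convexity: test each minimizer's variational inequality at the other one, add, and apply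
Cauchy–Schwarz. -/
theorem IsRegMin.norm_sub_le {K : Set E} (hK : Convex ℝ K) {h : ℝ} (hh : 0 < h) {z z' p p' : E}
    (hp : IsRegMin K h z p) (hp' : IsRegMin K h z' p') : ‖p - p'‖ ≤ ‖z - z'‖ / (2 * h) := by
  have h1 := hp.variational hK hp'.1
  have h2 := hp'.variational hK hp.1
  have h3 : 2 * h * ‖p - p'‖ ^ 2 ≤ inner ℝ (z' - z) (p - p') := by
    rw [← real_inner_self_eq_norm_sq, inner_sub_left (z') z]
    rw [← neg_sub p p', inner_neg_right, inner_neg_right] at h1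
    rw [inner_sub_left p p']
    linarith
  have h4 := h3.trans (real_inner_le_norm _ _)
  rw [norm_sub_rev z' z] at h4
  rw [le_div_iff₀ (by positivity)]
  by_cases h0 : ‖p - p'‖ = 0
  · rw [h0]; simp
  · have h5 : 0 < ‖p - p'‖ := lt_of_le_of_ne (norm_nonneg _) (Ne.symm h0)
    exact le_of_mul_le_mul_right (by nlinarith) h5

theorem exists_isRegMin {K : Set E} (hK : IsCompact K) (hne : K.Nonempty) (h : ℝ) (z : E) :
    ∃ p, IsRegMin K h z p := by
  obtain ⟨p, hp, hmin⟩ := hK.exists_isMinOn hne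
    (f := fun y => inner ℝ z y + h * ‖y‖ ^ 2) (by fun_prop)
  exact ⟨p, hp, hmin⟩

/-- Follow-the-leader/be-the-leader: playing the next regularized leader has regret at most the
value of the regularizer at the comparator. -/
theorem be_the_leader {K : Set E} {h : ℝ} (hh : 0 ≤ h) (g v : ℕ → E)
    (T : ℕ) (hv : ∀ t ≤ T, IsRegMin K h (∑ s ∈ Finset.range t, g s) (v t)) {y : E} (hy : y ∈ K) :
    ∑ t ∈ Finset.range T, inner ℝ (g t) (v (t + 1) - y) ≤ h * ‖y‖ ^ 2 := by
  have key : ∀ m ≤ T, ∑ t ∈ Finset.range m, inner ℝ (g t) (v (t + 1))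
      ≤ inner ℝ (∑ s ∈ Finset.range m, g s) (v m) + h * ‖v m‖ ^ 2 := by
    intro m
    induction m with
    | zero => intro _; simp; positivity
    | succ m ih =>
      intro hm
      have h1 := ih (by omega)
      have h2 := (hv m (by omega)).2 (hv (m + 1) hm).1
      simp only [Set.mem_ofPred_eq] at h2
      rw [Finset.sum_range_succ, Finset.sum_range_succ, inner_add_left]
      linarith
  have h1 := key T le_rfl
  have h2 := (hv T le_rfl).2 hy
  simp only [Set.mem_ofPred_eq] at h2
  simp only [inner_sub_right, Finset.sum_sub_distrib]
  rw [sum_inner (Finset.range T) g y] at h2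
  linarith

end FTRL

theorem argminOn_spec {d : ℕ} {K : Set (Vec d)} {φ : Vec d → ℝ} (h : ∃ x ∈ K, IsMinOn φ K x) :
    argminOn K φ ∈ K ∧ IsMinOn φ K (argminOn K φ) := by
  rw [argminOn, dif_pos h]
  exact h.choose_spec

theorem isRegMin_argminOn {d : ℕ} {K : Set (Vec d)} (hK : IsCompact K) (hne : K.Nonempty)
    (h : ℝ) (z : Vec d) :
    IsRegMin K h z (argminOn K (fun y => inner ℝ z y + h * ‖y‖ ^ 2)) :=
  argminOn_spec (exists_isRegMin hK hne h z)

theorem isRegMin_argminOn_norm {d : ℕ} {K : Set (Vec d)} (hK : IsCompact K) (hne : K.Nonempty)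
    {h : ℝ} (hh : 0 ≤ h) : IsRegMin K h 0 (argminOn K (fun y => ‖y‖)) := by
  obtain ⟨p, hp⟩ := hK.exists_isMinOn hne (f := fun y => ‖y‖) (by fun_prop)
  obtain ⟨h1, h2⟩ := argminOn_spec (φ := fun y : Vec d => ‖y‖) ⟨p, hp⟩
  refine ⟨h1, fun y hy => ?_⟩
  have h3 : ‖argminOn K (fun y => ‖y‖)‖ ≤ ‖y‖ := h2 hy
  simp only [Set.mem_ofPred_eq, inner_zero_left, zero_add]
  gcongr

/-- Stability makes the minimizer a Lipschitz function of the linear term; this is what makes the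
random decisions measurable. -/
theorem continuous_argminOn {d : ℕ} {K : Set (Vec d)} (hK : IsCompact K) (hne : K.Nonempty)
    (hconv : Convex ℝ K) {h : ℝ} (hh : 0 < h) :
    Continuous fun z : Vec d => argminOn K (fun y => inner ℝ z y + h * ‖y‖ ^ 2) := by
  refine (LipschitzWith.of_dist_le_mul (K := (1 / (2 * h)).toNNReal) fun z z' => ?_).continuous
  rw [dist_eq_norm, dist_eq_norm, Real.coe_toNNReal _ (by positivity), div_mul_eq_mul_div, one_mul]
  exact (isRegMin_argminOn hK hne h z).norm_sub_le hconv hh (isRegMin_argminOn hK hne h z')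

/-! ### The spectrum of `A - 11ᵀ/n` -/

section SingularValue

/-- One half of Courant–Fischer: `b` is a top eigenvector of `S* S`, and orthogonally to it only the
remaining eigenvalues, all at most `σ₂²`, contribute. -/
theorem norm_map_sq_le_of_inner_eq_zero {E : Type*} [NormedAddCommGroup E] [InnerProductSpace ℝ E]
    [FiniteDimensional ℝ E] (S : E →ₗ[ℝ] E) (hdim : 2 ≤ Module.finrank ℝ E) :
    ∃ b : E, ∀ w : E, inner ℝ b w = 0 → ‖S w‖ ^ 2 ≤ S.singularValues 1 ^ 2 * ‖w‖ ^ 2 := by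
  set hS := S.isSymmetric_adjoint_comp_self
  set b := hS.eigenvectorBasis rfl
  refine ⟨b ⟨0, by omega⟩, fun w hw => ?_⟩
  have h1 : ‖S w‖ ^ 2 = inner ℝ w ((S.adjoint ∘ₗ S) w) := by
    rw [LinearMap.comp_apply, LinearMap.adjoint_inner_right, real_inner_self_eq_norm_sq]
  rw [h1, ← b.sum_inner_mul_inner, ← b.sum_sq_norm_inner_right w, Finset.mul_sum]
  refine Finset.sum_le_sum fun i _ => ?_
  have h2 : inner ℝ (b i) ((S.adjoint ∘ₗ S) w) = hS.eigenvalues rfl i * inner ℝ (b i) w := by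
    rw [← hS (b i) w, hS.apply_eigenvectorBasis rfl i, inner_smul_left]
    simp [b]
  rw [h2, real_inner_comm, Real.norm_eq_abs, sq_abs]
  by_cases hi : (i : ℕ) = 0
  · have : i = ⟨0, by omega⟩ := Fin.ext hi
    rw [this, hw]
    simp
  · have h3 : hS.eigenvalues rfl i ≤ S.singularValues 1 ^ 2 := by
      rw [S.sq_singularValues_of_lt rfl (by omega : 1 < Module.finrank ℝ E)]
      exact hS.eigenvalues_antitone rfl (by rw [Fin.le_def]; simp; omega)
    nlinarith [sq_nonneg (inner ℝ (b i) w)]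

/-- The plane spanned by `x` and `y` contains a nonzero vector orthogonal to the `b` of
`norm_map_sq_le_of_inner_eq_zero`. If both eigenvalues `1` and `μ` exceeded the second singular
value, `S` would stretch this vector too much. -/
theorem le_singularValues_one {E : Type*} [NormedAddCommGroup E] [InnerProductSpace ℝ E]
    [FiniteDimensional ℝ E] (S : E →ₗ[ℝ] E) (hS : S.singularValues 1 < 1) {x y : E} {μ : ℝ}
    (hx : x ≠ 0) (hy : y ≠ 0) (hxy : inner ℝ x y = 0) (hSx : S x = x) (hSy : S y = μ • y) :
    μ ≤ S.singularValues 1 := by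
  have hx0 : 0 < ‖x‖ ^ 2 := by positivity
  have hy0 : 0 < ‖y‖ ^ 2 := by positivity
  have hdim : 2 ≤ Module.finrank ℝ E := by
    have h : LinearIndependent ℝ ![x, y] := by
      rw [LinearIndependent.pair_iff' hx]
      rintro a rfl
      rw [inner_smul_right, real_inner_self_eq_norm_sq] at hxy
      rcases mul_eq_zero.mp hxy with h | h
      · simp [h] at hy
      · exact hx0.ne' h
    simpa using h.fintype_card_le_finrank
  obtain ⟨b, hb⟩ := norm_map_sq_le_of_inner_eq_zero S hdim
  have h0 := S.singularValues_nonneg 1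
  set σ := S.singularValues 1
  by_contra! hμ
  obtain ⟨a, c, hac, hw⟩ : ∃ a c : ℝ, (a ≠ 0 ∨ c ≠ 0) ∧ inner ℝ b (a • x + c • y) = 0 := by
    by_cases h : inner ℝ b y = 0
    · exact ⟨0, 1, by simp, by simp [h]⟩
    · refine ⟨inner ℝ b y, -inner ℝ b x, Or.inl h, ?_⟩
      rw [inner_add_right, inner_smul_right, inner_smul_right]
      ring
  have h1 := hb _ hw
  have h2 : S (a • x + c • y) = a • x + (c * μ) • y := by
    rw [map_add, map_smul, map_smul, hSx, hSy, smul_smul]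
  have h3 : ∀ a c : ℝ, ‖a • x + c • y‖ ^ 2 = a ^ 2 * ‖x‖ ^ 2 + c ^ 2 * ‖y‖ ^ 2 := by
    intro a c
    rw [norm_add_sq_real, inner_smul_left, inner_smul_right, hxy, norm_smul, norm_smul, mul_pow,
      mul_pow, Real.norm_eq_abs, Real.norm_eq_abs, sq_abs, sq_abs]
    simp
  rw [h2, h3, h3] at h1
  have h4 : 0 < 1 - σ ^ 2 := by nlinarith
  have h5 : 0 < μ ^ 2 - σ ^ 2 := by nlinarith
  have h6 : a ^ 2 * ‖x‖ ^ 2 * (1 - σ ^ 2) + c ^ 2 * ‖y‖ ^ 2 * (μ ^ 2 - σ ^ 2) ≤ 0 := by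
    rw [mul_pow] at h1; linarith
  rcases hac with h | h
  · have : 0 < a ^ 2 * ‖x‖ ^ 2 * (1 - σ ^ 2) := by positivity
    have : 0 ≤ c ^ 2 * ‖y‖ ^ 2 * (μ ^ 2 - σ ^ 2) := by positivity
    linarith
  · have : 0 ≤ a ^ 2 * ‖x‖ ^ 2 * (1 - σ ^ 2) := by positivity
    have : 0 < c ^ 2 * ‖y‖ ^ 2 * (μ ^ 2 - σ ^ 2) := by positivity
    linarith

theorem sigma₂_nonneg {n : ℕ} (A : Matrix (Fin n) (Fin n) ℝ) : 0 ≤ sigma₂ A :=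
  LinearMap.singularValues_nonneg _ _

/-- `A - 11ᵀ/n`, the deviation of a communication matrix from averaging. -/
noncomputable def deviationMatrix {n : ℕ} (A : Matrix (Fin n) (Fin n) ℝ) :
    Matrix (Fin n) (Fin n) ℝ := A - Matrix.of fun _ _ => (n : ℝ)⁻¹

variable {n : ℕ} {𝒢 : SimpleGraph (Fin n)} {A : Matrix (Fin n) (Fin n) ℝ}

theorem IsCommunicationMatrix.row_sum (hA : IsCommunicationMatrix 𝒢 A) (i : Fin n) :
    ∑ j, A i j = 1 := (mem_doublyStochastic_iff_sum.mp hA.doublyStochastic).2.1 i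

theorem IsCommunicationMatrix.col_sum (hA : IsCommunicationMatrix 𝒢 A) (j : Fin n) :
    ∑ i, A i j = 1 := (mem_doublyStochastic_iff_sum.mp hA.doublyStochastic).2.2 j

theorem IsCommunicationMatrix.isHermitian_deviationMatrix (hA : IsCommunicationMatrix 𝒢 A) :
    (deviationMatrix A).IsHermitian := by
  ext i j
  simp [deviationMatrix, hA.symmetric.apply i j]

/-- The columns of the deviation matrix sum to zero, so an eigenvector with nonzero eigenvalue has
coordinate sum zero and is an eigenvector of `A` orthogonal to the all-ones vector. Positive
semidefiniteness gives the lower bound and `le_singularValues_one` the upper one. -/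
theorem IsCommunicationMatrix.eigenvalue_deviationMatrix (hA : IsCommunicationMatrix 𝒢 A)
    {v : Fin n → ℝ} (hv : v ≠ 0) {μ : ℝ} (h : (deviationMatrix A).mulVec v = μ • v) :
    0 ≤ μ ∧ μ ≤ sigma₂ A := by
  by_cases hμ : μ = 0
  · rw [hμ]; exact ⟨le_rfl, sigma₂_nonneg A⟩
  have hn : (n : ℝ) ≠ 0 := by
    rintro h0
    have : n = 0 := by exact_mod_cast h0
    subst this
    exact hv (Subsingleton.elim _ _)
  have happ : ∀ i, (deviationMatrix A).mulVec v i = A.mulVec v i - (n : ℝ)⁻¹ * ∑ j, v j := by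
    intro i
    simp [deviationMatrix, Matrix.mulVec, dotProduct, sub_mul, Finset.sum_sub_distrib,
      Finset.mul_sum]
  have hsumA : ∑ i, A.mulVec v i = ∑ j, v j := by
    simp only [Matrix.mulVec, dotProduct]
    rw [Finset.sum_comm]
    simp [← Finset.sum_mul, hA.col_sum]
  have hsum : ∑ j, v j = 0 := by
    have h1 : ∑ i, (deviationMatrix A).mulVec v i = 0 := by
      simp only [happ, Finset.sum_sub_distrib, hsumA]
      simp [hn]
    rw [h] at h1
    simp only [Pi.smul_apply, smul_eq_mul, ← Finset.mul_sum] at h1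
    exact (mul_eq_zero.mp h1).resolve_left hμ
  have hAv : A.mulVec v = μ • v := by
    rw [← h]; ext i; rw [happ, hsum]; simp
  constructor
  · have h1 := hA.posSemidef.dotProduct_mulVec_nonneg v
    rw [hAv] at h1
    simp only [star_trivial, dotProduct_smul, smul_eq_mul] at h1
    have h2 : 0 < dotProduct v v := by
      have := Matrix.dotProduct_star_self_pos_iff.mpr hv
      simpa using this
    exact nonneg_of_mul_nonneg_left h1 h2
  · refine le_singularValues_one (Matrix.toEuclideanLin A) hA.sigma₂_lt_one
      (x := WithLp.toLp 2 fun _ => 1) (y := WithLp.toLp 2 v) ?_ ?_ ?_ ?_ ?_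
    · intro h0
      have h1 : (fun _ : Fin n => (1 : ℝ)) = 0 := by simpa using h0
      apply hn
      have : ∑ _i : Fin n, (1 : ℝ) = 0 := by
        have := congrArg (fun u : Fin n → ℝ => ∑ i, u i) h1
        simpa using this
      simpa using this
    · simpa using hv
    · simp [PiLp.inner_apply, hsum]
    · rw [Matrix.toLpLin_apply]
      congr 1
      ext i
      simp [Matrix.mulVec, dotProduct, hA.row_sum]
    · rw [Matrix.toLpLin_apply]
      simp [hAv]

end SingularValue

/-! ### The scalar momentum recursion and its conserved energy -/

section Momentum

/-- With `τ = (1 + θ) l`, the left side is the form `1 - τ + θ` at the diagonal pair `(1, 1)`, and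
the bracket on the right is its normalizing factor `1 - τ²/(4θ)`. The bound thus says that a
diagonal pair has energy at most three times its squared norm; it also yields positivity of the
factor. The constant `3` is approached as `l = σ → 1`. -/
theorem mixing_bound {σ l : ℝ} (hl : 0 ≤ l) (hlσ : l ≤ σ) (hσ : σ < 1) :
    (1 + 1 / (1 + √(1 - σ ^ 2))) * (1 - l)
      ≤ 3 * (1 - ((1 + 1 / (1 + √(1 - σ ^ 2))) * l) ^ 2 / (4 * (1 / (1 + √(1 - σ ^ 2))))) := by
  have h1 : 0 < 1 - σ ^ 2 := by nlinarith
  set s := √(1 - σ ^ 2) with hs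
  have hs0 : 0 < s := Real.sqrt_pos.mpr h1
  have hs2 : s ^ 2 = 1 - σ ^ 2 := Real.sq_sqrt h1.le
  have hσ0 : 0 ≤ σ := hl.trans hlσ
  have hσσ : σ ^ 2 ≤ σ := by nlinarith
  have key : 3 * (2 + s) ^ 2 * l ^ 2 - 4 * (2 + s) * l ≤ 4 + 8 * s := by
    -- Replace `l` by `σ` where this increases the value and weaken the linear term by `σ² ≤ σ`;
    -- then `σ² = 1 - s²` leaves `4 + 8s - s² - 8s³ - 3s⁴`.
    have hA : 3 * (2 + s) ^ 2 * l ^ 2 - 4 * (2 + s) * l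
        ≤ l * (3 * (2 + s) ^ 2 * σ - 4 * (2 + s)) := by
      have : l * l ≤ l * σ := mul_le_mul_of_nonneg_left hlσ hl
      nlinarith [mul_le_mul_of_nonneg_left this (by positivity : 0 ≤ 3 * (2 + s) ^ 2)]
    refine hA.trans ?_
    by_cases hb : 3 * (2 + s) ^ 2 * σ - 4 * (2 + s) ≤ 0
    · have := mul_nonpos_of_nonneg_of_nonpos hl hb
      linarith
    · push Not at hb
      have hB := mul_le_mul_of_nonneg_right hlσ hb.le
      refine hB.trans ?_
      have hC : σ * (3 * (2 + s) ^ 2 * σ - 4 * (2 + s))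
          ≤ 3 * (2 + s) ^ 2 * σ ^ 2 - 4 * (2 + s) * σ ^ 2 := by
        nlinarith [mul_le_mul_of_nonneg_left hσσ (by positivity : 0 ≤ 4 * (2 + s))]
      have hσ2 : σ ^ 2 = 1 - s ^ 2 := by linarith
      rw [hσ2] at hC
      refine hC.trans ?_
      nlinarith [pow_pos hs0 3, pow_pos hs0 4, pow_pos hs0 2]
  have h2 : 3 * (1 - ((1 + 1 / (1 + s)) * l) ^ 2 / (4 * (1 / (1 + s)))) - (1 + 1 / (1 + s)) * (1 - l)
      = (4 + 8 * s - (3 * (2 + s) ^ 2 * l ^ 2 - 4 * (2 + s) * l)) / (4 * (1 + s)) := by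
    field_simp
    ring
  have h3 : 0 ≤ (4 + 8 * s - (3 * (2 + s) ^ 2 * l ^ 2 - 4 * (2 + s) * l)) / (4 * (1 + s)) :=
    div_nonneg (by linarith) (by positivity)
  linarith

variable {V : Type*} [NormedAddCommGroup V] [InnerProductSpace ℝ V]

/-- The second component of the energy vector of the recursion `x' = τ x - θ y`. -/
noncomputable def momentumPart (θ τ : ℝ) (x y : V) : V :=
  (1 / √(1 - τ ^ 2 / (4 * θ))) • (√θ • y - (τ / (2 * √θ)) • x)

/-- Completing the square in `y`. Writing the quadratic form as the squared norm of a vector linear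
in `(x, y)` makes the triangle inequality available when gradients are added. -/
theorem momentum_energy {θ τ : ℝ} (hθ : 0 < θ) (hκ : 0 < 1 - τ ^ 2 / (4 * θ)) (x y : V) :
    ‖x‖ ^ 2 + ‖momentumPart θ τ x y‖ ^ 2
      = (‖x‖ ^ 2 - τ * inner ℝ x y + θ * ‖y‖ ^ 2) / (1 - τ ^ 2 / (4 * θ)) := by
  have h1 : √θ ^ 2 = θ := Real.sq_sqrt hθ.le
  have h1' : 0 < √θ := Real.sqrt_pos.mpr hθ
  have h2 : √(1 - τ ^ 2 / (4 * θ)) ^ 2 = 1 - τ ^ 2 / (4 * θ) := Real.sq_sqrt hκ.le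
  have h3 : ‖√θ • y - (τ / (2 * √θ)) • x‖ ^ 2
      = θ * ‖y‖ ^ 2 - τ * inner ℝ x y + τ ^ 2 / (4 * θ) * ‖x‖ ^ 2 := by
    rw [norm_sub_sq_real, inner_smul_left, inner_smul_right, norm_smul, norm_smul, mul_pow,
      mul_pow, Real.norm_eq_abs, Real.norm_eq_abs, sq_abs, sq_abs, h1, div_pow, mul_pow, h1,
      real_inner_comm]
    simp only [conj_trivial]
    field_simp
    ring
  rw [momentumPart, norm_smul, mul_pow, h3, Real.norm_eq_abs, sq_abs, div_pow, one_pow, h2]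
  generalize τ ^ 2 / (4 * θ) = q at hκ ⊢
  field_simp
  ring

/-- The companion matrix of the recursion has determinant `θ`, and when its eigenvalues are not real
both have modulus `√θ`; this form is the one it scales by `θ`. -/
theorem momentum_energy_step (θ τ : ℝ) (x y : V) :
    ‖τ • x - θ • y‖ ^ 2 - τ * inner ℝ (τ • x - θ • y) x + θ * ‖x‖ ^ 2
      = θ * (‖x‖ ^ 2 - τ * inner ℝ x y + θ * ‖y‖ ^ 2) := by
  rw [norm_sub_sq_real, inner_sub_left, inner_smul_left, inner_smul_left, inner_smul_left,
    inner_smul_right, norm_smul, norm_smul, mul_pow, mul_pow, Real.norm_eq_abs, Real.norm_eq_abs,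
    sq_abs, sq_abs, real_inner_self_eq_norm_sq, real_inner_comm]
  simp only [conj_trivial]
  ring

theorem momentumPart_add (θ τ : ℝ) (x y x' y' : V) :
    momentumPart θ τ (x + x') (y + y') = momentumPart θ τ x y + momentumPart θ τ x' y' := by
  simp only [momentumPart, ← smul_add]
  congr 1
  module

end Momentum

/-! ### Energy of vector families in the eigenbasis -/

section Coordinates

variable {n : ℕ} {V : Type*} [NormedAddCommGroup V] [InnerProductSpace ℝ V]
  {B : Matrix (Fin n) (Fin n) ℝ} (hB : B.IsHermitian)

/-- The coordinates of a family of vectors in the eigenbasis of a symmetric matrix. -/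
noncomputable def eigenCoord (Y : Fin n → V) (l : Fin n) : V :=
  ∑ i, hB.eigenvectorBasis l i • Y i

theorem eigenCoord_add (Y Y' : Fin n → V) (l : Fin n) :
    eigenCoord hB (fun i => Y i + Y' i) l = eigenCoord hB Y l + eigenCoord hB Y' l := by
  simp [eigenCoord, Finset.sum_add_distrib]

theorem eigenCoord_step (Y Y' : Fin n → V) (a b : ℝ) (l : Fin n) :
    eigenCoord hB (fun i => a • (∑ j, B i j • Y j) - b • Y' i) l
      = (a * hB.eigenvalues l) • eigenCoord hB Y l - b • eigenCoord hB Y' l := by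
  have h1 : ∀ j, ∑ i, hB.eigenvectorBasis l i * B i j
      = hB.eigenvalues l * hB.eigenvectorBasis l j := by
    intro j
    have h := congrFun (hB.mulVec_eigenvectorBasis l) j
    simp only [Matrix.mulVec, dotProduct, Pi.smul_apply, smul_eq_mul] at h
    rw [← h]
    refine Finset.sum_congr rfl fun i _ => ?_
    have : B i j = B j i := by simpa using hB.apply j i
    rw [this, mul_comm]
  have h2 : ∑ i, hB.eigenvectorBasis l i • (∑ j, B i j • Y j)
      = hB.eigenvalues l • eigenCoord hB Y l := by
    simp only [eigenCoord, Finset.smul_sum, smul_smul]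
    rw [Finset.sum_comm]
    refine Finset.sum_congr rfl fun j _ => ?_
    rw [← Finset.sum_smul, h1]
  rw [mul_smul, ← h2]
  simp only [eigenCoord, smul_sub, Finset.sum_sub_distrib, Finset.smul_sum (r := a),
    Finset.smul_sum (r := b), smul_comm a, smul_comm b]

theorem sum_norm_sq_eigenCoord (Y : Fin n → V) :
    ∑ l, ‖eigenCoord hB Y l‖ ^ 2 = ∑ i, ‖Y i‖ ^ 2 := by
  have h1 : ∀ i j, ∑ l, hB.eigenvectorBasis l i * hB.eigenvectorBasis l j
      = if i = j then 1 else 0 := by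
    intro i j
    have h := congrFun (congrFun (Unitary.coe_mul_star_self hB.eigenvectorUnitary) i) j
    simpa [Matrix.mul_apply, Matrix.one_apply] using h
  have h2 : ∀ l, ‖eigenCoord hB Y l‖ ^ 2 = ∑ i, ∑ j,
      hB.eigenvectorBasis l i * hB.eigenvectorBasis l j * inner ℝ (Y i) (Y j) := by
    intro l
    rw [← real_inner_self_eq_norm_sq, eigenCoord, sum_inner]
    refine Finset.sum_congr rfl fun i _ => ?_
    rw [inner_sum]
    refine Finset.sum_congr rfl fun j _ => ?_
    rw [inner_smul_left, inner_smul_right, mul_assoc]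
    simp
  simp only [h2]
  rw [Finset.sum_comm]
  refine Finset.sum_congr rfl fun i _ => ?_
  rw [Finset.sum_comm]
  simp only [← Finset.sum_mul, h1]
  simp

/-- The energy vector of a pair of consecutive gossip variables. -/
noncomputable def energyVec (θ : ℝ) (Y Y' : Fin n → V) : PiLp 2 fun _ : Fin n ⊕ Fin n => V :=
  WithLp.toLp 2 (Sum.elim (eigenCoord hB Y) fun l =>
    momentumPart θ ((1 + θ) * hB.eigenvalues l) (eigenCoord hB Y l) (eigenCoord hB Y' l))

theorem energyVec_add (θ : ℝ) (Y Y' G G' : Fin n → V) :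
    energyVec hB θ (fun i => Y i + G i) (fun i => Y' i + G' i)
      = energyVec hB θ Y Y' + energyVec hB θ G G' := by
  ext l
  rcases l with l | l
  · simp [energyVec, eigenCoord_add]
  · simp [energyVec, eigenCoord_add, momentumPart_add]

theorem norm_sq_energyVec (θ : ℝ) (Y Y' : Fin n → V) :
    ‖energyVec hB θ Y Y'‖ ^ 2 = ∑ l, (‖eigenCoord hB Y l‖ ^ 2 +
      ‖momentumPart θ ((1 + θ) * hB.eigenvalues l) (eigenCoord hB Y l) (eigenCoord hB Y' l)‖ ^ 2) := by
  rw [PiLp.norm_sq_eq_of_L2, Fintype.sum_sum_type, Finset.sum_add_distrib]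
  simp [energyVec]

theorem norm_le_norm_energyVec (θ : ℝ) (Y Y' : Fin n → V) (i : Fin n) :
    ‖Y i‖ ≤ ‖energyVec hB θ Y Y'‖ := by
  refine le_of_sq_le_sq ?_ (norm_nonneg _)
  rw [norm_sq_energyVec]
  calc ‖Y i‖ ^ 2 ≤ ∑ i, ‖Y i‖ ^ 2 :=
        Finset.single_le_sum (f := fun i => ‖Y i‖ ^ 2) (fun _ _ => by positivity) (Finset.mem_univ i)
    _ = ∑ l, ‖eigenCoord hB Y l‖ ^ 2 := (sum_norm_sq_eigenCoord hB Y).symm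
    _ ≤ _ := Finset.sum_le_sum fun l _ => le_add_of_nonneg_right (by positivity)

theorem discriminant_pos {σ : ℝ} (hσ : σ < 1)
    (hev : ∀ l, 0 ≤ hB.eigenvalues l ∧ hB.eigenvalues l ≤ σ) (l : Fin n) :
    0 < 1 - ((1 + 1 / (1 + √(1 - σ ^ 2))) * hB.eigenvalues l) ^ 2
      / (4 * (1 / (1 + √(1 - σ ^ 2)))) := by
  have h := mixing_bound (hev l).1 (hev l).2 hσ
  have h1 : 0 < (1 + 1 / (1 + √(1 - σ ^ 2))) * (1 - hB.eigenvalues l) :=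
    mul_pos (by positivity) (by linarith [(hev l).2])
  linarith

theorem norm_energyVec_step {σ : ℝ} (hσ : σ < 1)
    (hev : ∀ l, 0 ≤ hB.eigenvalues l ∧ hB.eigenvalues l ≤ σ) (Y Y' : Fin n → V) {θ : ℝ} (hθ : θ = 1 / (1 + √(1 - σ ^ 2))) :
    ‖energyVec hB θ (fun i => (1 + θ) • (∑ j, B i j • Y j) - θ • Y' i) Y‖
      = √θ * ‖energyVec hB θ Y Y'‖ := by
  have hθ0 : 0 < θ := by rw [hθ]; positivity
  refine (sq_eq_sq₀ (norm_nonneg _) (by positivity)).mp ?_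
  rw [mul_pow, Real.sq_sqrt hθ0.le, norm_sq_energyVec, norm_sq_energyVec, Finset.mul_sum]
  refine Finset.sum_congr rfl fun l _ => ?_
  have hκ := discriminant_pos hB hσ hev l
  rw [← hθ] at hκ
  rw [momentum_energy hθ0 hκ, momentum_energy hθ0 hκ, eigenCoord_step, momentum_energy_step,
    mul_div_assoc]

theorem norm_energyVec_diag_le {σ : ℝ} (hσ : σ < 1)
    (hev : ∀ l, 0 ≤ hB.eigenvalues l ∧ hB.eigenvalues l ≤ σ) (Y : Fin n → V) {θ : ℝ} (hθ : θ = 1 / (1 + √(1 - σ ^ 2))) :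
    ‖energyVec hB θ Y Y‖ ^ 2 ≤ 3 * ∑ i, ‖Y i‖ ^ 2 := by
  have hθ0 : 0 < θ := by rw [hθ]; positivity
  rw [norm_sq_energyVec, ← sum_norm_sq_eigenCoord hB Y, Finset.mul_sum]
  refine Finset.sum_le_sum fun l _ => ?_
  have hκ := discriminant_pos hB hσ hev l
  have hb := mixing_bound (hev l).1 (hev l).2 hσ
  rw [← hθ] at hκ hb
  rw [momentum_energy hθ0 hκ, div_le_iff₀ hκ, real_inner_self_eq_norm_sq]
  have := mul_le_mul_of_nonneg_right hb (sq_nonneg ‖eigenCoord hB Y l‖)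
  linarith

end Coordinates

/-! ### Averages over the learners -/

section Average

variable {n d : ℕ}

/-- The average of a family of vectors. -/
noncomputable def avg (Y : Fin n → Vec d) : Vec d := (n : ℝ)⁻¹ • ∑ i, Y i

theorem avg_add (Y Y' : Fin n → Vec d) : avg (fun i => Y i + Y' i) = avg Y + avg Y' := by
  simp [avg, Finset.sum_add_distrib]

theorem norm_avg_le {Y : Fin n → Vec d} {c : ℝ} (hc : 0 ≤ c) (hY : ∀ i, ‖Y i‖ ≤ c) :
    ‖avg Y‖ ≤ c := by
  rw [avg, norm_smul, Real.norm_eq_abs, abs_inv, Nat.abs_cast]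
  rcases Nat.eq_zero_or_pos n with h | h
  · subst h; simpa using hc
  · have h1 : ‖∑ i, Y i‖ ≤ n * c := by
      simpa using norm_sum_le_of_le Finset.univ (fun i _ => hY i)
    have hn : (0 : ℝ) < n := by exact_mod_cast h
    calc (n : ℝ)⁻¹ * ‖∑ i, Y i‖ ≤ (n : ℝ)⁻¹ * (n * c) := by gcongr
      _ = c := by field_simp

theorem sum_norm_sub_avg_sq_le (Y : Fin n → Vec d) :
    ∑ i, ‖Y i - avg Y‖ ^ 2 ≤ ∑ i, ‖Y i‖ ^ 2 := by
  rcases Nat.eq_zero_or_pos n with h | h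
  · subst h; simp
  have hn : (n : ℝ) ≠ 0 := by positivity
  have h1 : ∑ i, inner ℝ (Y i) (avg Y) = n * ‖avg Y‖ ^ 2 := by
    rw [← sum_inner]
    have : ∑ i, Y i = (n : ℝ) • avg Y := by rw [avg, smul_smul, mul_inv_cancel₀ hn, one_smul]
    rw [this, inner_smul_left, real_inner_self_eq_norm_sq]
    simp
  have h2 : ∑ i, ‖Y i - avg Y‖ ^ 2 = ∑ i, ‖Y i‖ ^ 2 - n * ‖avg Y‖ ^ 2 := by
    simp only [norm_sub_sq_real, Finset.sum_add_distrib, Finset.sum_sub_distrib, ← Finset.mul_sum,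
      h1]
    simp
    ring
  rw [h2]
  linarith [show 0 ≤ n * ‖avg Y‖ ^ 2 by positivity]

end Average

/-! ### Contraction of accelerated gossip over a block -/

section Gossip

variable {n d : ℕ} {𝒢 : SimpleGraph (Fin n)} {A : Matrix (Fin n) (Fin n) ℝ}

/-- One step of accelerated gossip. -/
noncomputable def gossipStep (A : Matrix (Fin n) (Fin n) ℝ) (θ : ℝ) (Y Y' : Fin n → Vec d)
    (i : Fin n) : Vec d := (1 + θ) • (∑ j, A i j • Y j) - θ • Y' i

/-- The energy of the deviations from the average of two consecutive gossip variables. -/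
noncomputable def gossipEnergy (hA : IsCommunicationMatrix 𝒢 A) (Y Y' : Fin n → Vec d) : ℝ :=
  ‖energyVec hA.isHermitian_deviationMatrix (mixingRatio A) (fun i => Y i - avg Y)
    (fun i => Y' i - avg Y')‖

theorem avg_gossipStep (hA : IsCommunicationMatrix 𝒢 A) (θ : ℝ) (Y Y' : Fin n → Vec d) :
    avg (gossipStep A θ Y Y') = (1 + θ) • avg Y - θ • avg Y' := by
  have h1 : ∑ i, ∑ j, A i j • Y j = ∑ j, Y j := by
    rw [Finset.sum_comm]
    simp [← Finset.sum_smul, hA.col_sum]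
  simp only [avg, gossipStep, Finset.sum_sub_distrib, ← Finset.smul_sum, h1]
  module

theorem gossipStep_sub_avg (hA : IsCommunicationMatrix 𝒢 A) (θ : ℝ) (Y Y' : Fin n → Vec d)
    (i : Fin n) : gossipStep A θ Y Y' i - avg (gossipStep A θ Y Y')
      = (1 + θ) • (∑ j, deviationMatrix A i j • (Y j - avg Y)) - θ • (Y' i - avg Y') := by
  have hn : (n : ℝ) ≠ 0 := by
    have : 0 < n := i.pos
    positivity
  have h1 : ∑ j, deviationMatrix A i j • (Y j - avg Y) = ∑ j, A i j • Y j - avg Y := by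
    simp only [deviationMatrix, Matrix.sub_apply, Matrix.of_apply, smul_sub, sub_smul,
      Finset.sum_sub_distrib, ← Finset.sum_smul, hA.row_sum, ← Finset.smul_sum]
    have h2 : (n : ℝ)⁻¹ • ∑ j, Y j = avg Y := rfl
    have h3 : ∑ _j : Fin n, (n : ℝ)⁻¹ = 1 := by simp [hn]
    rw [h2, h3]
    abel
  rw [avg_gossipStep hA, h1, gossipStep]
  module

theorem IsCommunicationMatrix.eigenvalues_deviationMatrix (hA : IsCommunicationMatrix 𝒢 A)
    (l : Fin n) : 0 ≤ hA.isHermitian_deviationMatrix.eigenvalues l ∧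
      hA.isHermitian_deviationMatrix.eigenvalues l ≤ sigma₂ A := by
  refine hA.eigenvalue_deviationMatrix ?_ (hA.isHermitian_deviationMatrix.mulVec_eigenvectorBasis l)
  have h := hA.isHermitian_deviationMatrix.eigenvectorBasis.orthonormal.ne_zero l
  simpa using h

theorem gossipEnergy_step (hA : IsCommunicationMatrix 𝒢 A) (Y Y' : Fin n → Vec d) :
    gossipEnergy hA (gossipStep A (mixingRatio A) Y Y') Y
      = √(mixingRatio A) * gossipEnergy hA Y Y' := by
  simp only [gossipEnergy, gossipStep_sub_avg hA]
  exact norm_energyVec_step _ hA.sigma₂_lt_one hA.eigenvalues_deviationMatrix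
    (fun i => Y i - avg Y) _ rfl

/-- The same `G` enters both consecutive variables, so the increment is a diagonal pair, to which
the factor `3` of `mixing_bound` applies. -/
theorem gossipEnergy_add_le (hA : IsCommunicationMatrix 𝒢 A) (Y Y' : Fin n → Vec d)
    {G : Fin n → Vec d} {c : ℝ} (hc : 0 ≤ c) (hG : ∀ i, ‖G i‖ ≤ c) :
    gossipEnergy hA (fun i => Y i + G i) (fun i => Y' i + G i)
      ≤ gossipEnergy hA Y Y' + √3 * √n * c := by
  have h1 : ∀ Y : Fin n → Vec d, (fun i => Y i + G i - avg (fun i => Y i + G i))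
      = fun i => (Y i - avg Y) + (G i - avg G) := by
    intro Y; ext1 i; rw [avg_add]; abel
  simp only [gossipEnergy, h1]
  rw [energyVec_add]
  refine (norm_add_le _ _).trans (add_le_add_right ?_ _)
  refine le_of_sq_le_sq ?_ (by positivity)
  refine (norm_energyVec_diag_le _ hA.sigma₂_lt_one hA.eigenvalues_deviationMatrix _ rfl).trans ?_
  rw [mul_pow, mul_pow, Real.sq_sqrt (by norm_num), Real.sq_sqrt (by positivity), mul_assoc]
  refine mul_le_mul_of_nonneg_left ((sum_norm_sub_avg_sq_le G).trans ?_) (by norm_num)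
  calc ∑ i, ‖G i‖ ^ 2 ≤ ∑ _i : Fin n, c ^ 2 :=
        Finset.sum_le_sum fun i _ => pow_le_pow_left₀ (norm_nonneg _) (hG i) 2
    _ = n * c ^ 2 := by simp

theorem norm_sub_avg_le_gossipEnergy (hA : IsCommunicationMatrix 𝒢 A) (Y Y' : Fin n → Vec d)
    (i : Fin n) : ‖Y i - avg Y‖ ≤ gossipEnergy hA Y Y' :=
  norm_le_norm_energyVec _ _ (fun i => Y i - avg Y) _ i

theorem gossipEnergy_zero (hA : IsCommunicationMatrix 𝒢 A) :
    gossipEnergy hA (fun _ => (0 : Vec d)) (fun _ => 0) = 0 := by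
  have h : (fun _ : Fin n => (0 : Vec d) - avg (fun _ : Fin n => 0)) = 0 := by
    ext1 i; simp [avg]
  have h2 := norm_energyVec_diag_le hA.isHermitian_deviationMatrix hA.sigma₂_lt_one
    hA.eigenvalues_deviationMatrix (0 : Fin n → Vec d) rfl
  rw [gossipEnergy, h]
  simp only [Pi.zero_apply, norm_zero, ne_eq, OfNat.ofNat_ne_zero, not_false_eq_true, zero_pow,
    Finset.sum_const_zero, mul_zero] at h2
  exact pow_eq_zero_iff two_ne_zero |>.mp (le_antisymm h2 (sq_nonneg _))

theorem spectralGap_pos (hA : IsCommunicationMatrix 𝒢 A) : 0 < spectralGap A :=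
  sub_pos.mpr hA.sigma₂_lt_one

theorem spectralGap_le_one (A : Matrix (Fin n) (Fin n) ℝ) : spectralGap A ≤ 1 :=
  sub_le_self _ (sigma₂_nonneg A)

/-- On `[0,1]` the convex function `(1 + u)^(-1/2)` lies below its chord, of slope `-(1 - 1/√2)`.
This slope is the source of the constant `√2 / (√2 - 1)` in the block size. -/
theorem inv_sqrt_one_add_le {u s : ℝ} (hu : 0 ≤ u) (hu1 : u ≤ 1) (hus : u ≤ s) :
    √(1 / (1 + s)) ≤ 1 - (1 - 1 / √2) * u := by
  have h2 : √2 ^ 2 = (2 : ℝ) := Real.sq_sqrt (by norm_num)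
  have h2' : 1 < √2 := by rw [Real.lt_sqrt (by norm_num)]; norm_num
  set a := 1 - 1 / √2 with ha
  have ha1 : 2 * a ^ 2 - 4 * a + 1 = 0 := by
    rw [ha]; field_simp; nlinarith
  have ha0 : 0 < a := by
    rw [ha, sub_pos, div_lt_one (by linarith)]; exact h2'
  have ha2 : a < 1 / 3 := by
    by_contra! h
    have : a < 1 := by rw [ha]; linarith [show 0 < 1 / √2 by positivity]
    nlinarith
  rw [Real.sqrt_le_left (by nlinarith)]
  rw [div_le_iff₀ (by linarith)]
  have h3 : 1 ≤ (1 - a * u) ^ 2 * (1 + u) := by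
    have : (1 - a * u) ^ 2 * (1 + u) - 1 = u * ((1 - u) * ((1 - 2 * a) - a ^ 2 * u)) := by
      linear_combination u ^ 2 * ha1
    have h4 : 0 ≤ (1 - 2 * a) - a ^ 2 * u := by nlinarith [sq_nonneg a]
    have := mul_nonneg hu (mul_nonneg (sub_nonneg.mpr hu1) h4)
    linarith
  nlinarith [sq_nonneg (1 - a * u)]

/-- Since `1 - σ² ≥ 1 - σ`, the chord bound with `u = √ρ` gives `√θ ≤ exp (-(1 - 1/√2) √ρ)`, and the
block size is chosen so that the `C`-th power is at most `1/√(14 n)`. -/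
theorem mixingRatio_pow_blockSize_le (hA : IsCommunicationMatrix 𝒢 A) (hn : 0 < n) :
    √(mixingRatio A) ^ blockSize A ≤ 1 / √(14 * n) := by
  have hρ := spectralGap_pos hA
  have hρ1 := spectralGap_le_one A
  have hσ := sigma₂_nonneg A
  have hρs : √(spectralGap A) ≤ √(1 - sigma₂ A ^ 2) := by
    apply Real.sqrt_le_sqrt
    rw [spectralGap] at hρ hρ1 ⊢
    nlinarith
  have hρ0 : 0 < √(spectralGap A) := Real.sqrt_pos.mpr hρ
  have h2' : 1 < √2 := by rw [Real.lt_sqrt (by norm_num)]; norm_num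
  have h1 := inv_sqrt_one_add_le hρ0.le (Real.sqrt_le_one.mpr hρ1) hρs
  have hn' : (0 : ℝ) < √(14 * n) := by positivity
  have hC : Real.log √(14 * n) ≤ (1 - 1 / √2) * √(spectralGap A) * blockSize A := by
    have h := Nat.le_ceil (√2 * Real.log √(14 * n) / ((√2 - 1) * √(spectralGap A)))
    rw [div_le_iff₀ (mul_pos (by linarith) hρ0)] at h
    rw [blockSize]
    have h3 : (1 - 1 / √2) = (√2 - 1) / √2 := by field_simp
    rw [h3, div_mul_eq_mul_div, div_mul_eq_mul_div, le_div_iff₀ (by positivity)]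
    linarith
  calc √(mixingRatio A) ^ blockSize A
      ≤ Real.exp (-((1 - 1 / √2) * √(spectralGap A))) ^ blockSize A := by
        refine pow_le_pow_left₀ (by positivity) (h1.trans ?_) _
        have := Real.add_one_le_exp (-((1 - 1 / √2) * √(spectralGap A)))
        linarith
    _ = Real.exp (-((1 - 1 / √2) * √(spectralGap A) * blockSize A)) := by
        rw [← Real.exp_nat_mul]; congr 1; ring
    _ ≤ Real.exp (-Real.log √(14 * n)) := Real.exp_le_exp.mpr (neg_le_neg hC)
    _ = 1 / √(14 * n) := by rw [Real.exp_neg, Real.exp_log hn', one_div]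

theorem blockSize_pos (hA : IsCommunicationMatrix 𝒢 A) (hn : 0 < n) : 0 < blockSize A := by
  rw [blockSize, Nat.ceil_pos]
  have h2' : 1 < √2 := by rw [Real.lt_sqrt (by norm_num)]; norm_num
  have hn1 : (1 : ℝ) ≤ n := by exact_mod_cast hn
  have h3 : 0 < Real.log √(14 * n) := by
    apply Real.log_pos
    rw [Real.lt_sqrt (by norm_num)]
    linarith
  exact div_pos (by positivity) (mul_pos (by linarith) (Real.sqrt_pos.mpr (spectralGap_pos hA)))

end Gossip

/-! ### Pathwise regret of AD-FTRL -/

section Pathwise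

variable {n d : ℕ} {𝒢 : SimpleGraph (Fin n)} {A : Matrix (Fin n) (Fin n) ℝ}

theorem gradient_inner_left (g x : Vec d) : gradient (fun y => inner ℝ g y) x = g :=
  HasGradientAt.gradient (InnerProductSpace.toDual ℝ (Vec d) g).hasFDerivAt

/-- The invariant of AD-FTRL, where `S` is the sum of the averaged gradients of all finished
rounds and `Γ` bounds the gradients. -/
structure ADFTRLInvariant (hA : IsCommunicationMatrix 𝒢 A) (K : Set (Vec d)) (h Γ : ℝ)
    (s : ADFTRLState n d) (S : Vec d) : Prop where
  k_lt : s.k < blockSize A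
  avg_prev : avg s.prev = avg s.cur
  avg_cur : avg s.cur + avg s.acc = S
  norm_acc_le : ∀ i, ‖s.acc i‖ ≤ s.k * Γ
  energy_le : gossipEnergy hA s.cur s.prev
    ≤ √(mixingRatio A) ^ s.k * (2 * (√3 * √n * (blockSize A * Γ)))
  isRegMin : ∀ i, ∃ z, IsRegMin K h z (s.x i) ∧ ‖z - avg s.cur‖ ≤ 3 * (blockSize A * Γ)

theorem ADFTRLInvariant.start (hA : IsCommunicationMatrix 𝒢 A) (hn : 0 < n) {K : Set (Vec d)}
    (hK : IsCompact K) (hne : K.Nonempty) {h Γ : ℝ} (hh : 0 < h) (hΓ : 0 ≤ Γ) (L : ℕ) (θ : ℝ) :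
    ADFTRLInvariant hA K h Γ (ADFTRL K A L θ h).start 0 where
  k_lt := blockSize_pos hA hn
  avg_prev := rfl
  avg_cur := by simp [ADFTRL, avg]
  norm_acc_le i := by simp [ADFTRL]
  energy_le := by
    refine (gossipEnergy_zero hA).le.trans ?_
    positivity
  isRegMin i := ⟨0, isRegMin_argminOn_norm hK hne hh.le, by simp [ADFTRL, avg]; positivity⟩

theorem mixingRatio_pow_blockSize_bounds (hA : IsCommunicationMatrix 𝒢 A) (hn : 0 < n) :
    √(mixingRatio A) ^ blockSize A ≤ 1 / 2 ∧
      √(mixingRatio A) ^ blockSize A * (√3 * √n) ≤ 1 := by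
  have h := mixingRatio_pow_blockSize_le hA hn
  have hn1 : (1 : ℝ) ≤ n := by exact_mod_cast hn
  constructor
  · refine h.trans (one_div_le_one_div_of_le (by norm_num) ?_)
    rw [Real.le_sqrt' (by norm_num)]
    linarith
  · calc √(mixingRatio A) ^ blockSize A * (√3 * √n) ≤ 1 / √(14 * n) * (√3 * √n) := by gcongr
      _ = √(3 * n) / √(14 * n) := by rw [Real.sqrt_mul (by norm_num : (0 : ℝ) ≤ 3) (n : ℝ)]; ring
      _ ≤ 1 := by
        rw [div_le_one (by positivity)]
        apply Real.sqrt_le_sqrt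
        linarith

/-- Gossip preserves the average because consecutive variables have equal averages, so the network
average carries the exact gradient sum. Within a block only the energy decays; at its end the
gradients are injected and the decisions recomputed. -/
theorem ADFTRLInvariant.step {hA : IsCommunicationMatrix 𝒢 A} (hn : 0 < n) {K : Set (Vec d)}
    (hK : IsCompact K) (hne : K.Nonempty) {h Γ : ℝ} (hΓ : 0 ≤ Γ)
    {s : ADFTRLState n d} {S : Vec d} (hs : ADFTRLInvariant hA K h Γ s S) {g : Fin n → Vec d}
    (hg : ∀ i, ‖g i‖ ≤ Γ) :
    ADFTRLInvariant hA K h Γ (ADFTRLStep K A (blockSize A) (mixingRatio A) h s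
      (fun i x => inner ℝ (g i) x)) (S + avg g) := by
  have hrw : (fun i => (1 + mixingRatio A) • (∑ j, A i j • s.cur j) - mixingRatio A • s.prev i)
      = gossipStep A (mixingRatio A) s.cur s.prev := rfl
  have hacc : ∀ i, ‖s.acc i + g i‖ ≤ (s.k + 1 : ℕ) * Γ := by
    intro i
    have := (norm_add_le _ _).trans (add_le_add (hs.norm_acc_le i) (hg i))
    push_cast
    linarith
  have havg : avg (gossipStep A (mixingRatio A) s.cur s.prev) = avg s.cur := by
    rw [avg_gossipStep hA, hs.avg_prev]
    module
  have hE : gossipEnergy hA (gossipStep A (mixingRatio A) s.cur s.prev) s.cur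
      ≤ √(mixingRatio A) ^ (s.k + 1) * (2 * (√3 * √n * (blockSize A * Γ))) := by
    rw [gossipEnergy_step, pow_succ', mul_assoc]
    exact mul_le_mul_of_nonneg_left hs.energy_le (Real.sqrt_nonneg _)
  simp only [ADFTRLStep, gradient_inner_left, hrw]
  split_ifs with hk
  · refine ⟨hk, havg.symm, ?_, hacc, hE, ?_⟩
    · change avg (gossipStep A (mixingRatio A) s.cur s.prev) + avg (fun i => s.acc i + g i) = _
      rw [havg, avg_add, ← add_assoc, hs.avg_cur]
    · intro i
      obtain ⟨z, hz, hzb⟩ := hs.isRegMin i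
      refine ⟨z, hz, ?_⟩
      change ‖z - avg (gossipStep A (mixingRatio A) s.cur s.prev)‖ ≤ _
      rwa [havg]
  · have hkC : s.k + 1 = blockSize A := by have := hs.k_lt; omega
    rw [hkC] at hE hacc
    obtain ⟨h1, h2⟩ := mixingRatio_pow_blockSize_bounds hA hn
    have hCΓ : 0 ≤ blockSize A * Γ := by positivity
    refine ⟨blockSize_pos hA hn, ?_, ?_, by simp, ?_, ?_⟩
    · change avg (fun i => s.cur i + (s.acc i + g i)) =
        avg (fun i => gossipStep A (mixingRatio A) s.cur s.prev i + (s.acc i + g i))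
      rw [avg_add s.cur, avg_add (gossipStep A (mixingRatio A) s.cur s.prev), havg]
    · change avg (fun i => gossipStep A (mixingRatio A) s.cur s.prev i + (s.acc i + g i))
        + avg (fun _ => 0) = _
      rw [avg_add, avg_add, havg, ← hs.avg_cur]
      simp [avg, add_assoc]
    -- With `B = √3 √n C Γ`, the bound `2B` is the fixed point of `E ↦ E/2 + B`: the block halves
    -- the energy and the injection adds at most `B`.
    · refine (gossipEnergy_add_le hA (gossipStep A (mixingRatio A) s.cur s.prev) s.cur hCΓ hacc).trans ?_
      simp only [pow_zero, one_mul]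
      have : 0 ≤ 2 * (√3 * √n * (blockSize A * Γ)) := by positivity
      linarith [mul_le_mul_of_nonneg_right h1 this]
    · intro i
      refine ⟨_, isRegMin_argminOn hK hne h _, ?_⟩
      change ‖gossipStep A (mixingRatio A) s.cur s.prev i -
        avg (fun i => gossipStep A (mixingRatio A) s.cur s.prev i + (s.acc i + g i))‖ ≤ _
      -- The new decision uses `z` before injection: gossip error contributes `2CΓ`, and the missing
      -- average gradient of the block another `CΓ`.
      rw [avg_add, ← sub_sub]
      have h3 := norm_sub_avg_le_gossipEnergy hA (gossipStep A (mixingRatio A) s.cur s.prev) s.cur i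
      have h4 := norm_avg_le hCΓ hacc
      have h5 := mul_le_mul_of_nonneg_right h2 (by positivity : 0 ≤ 2 * (blockSize A * Γ))
      refine (norm_sub_le _ _).trans ?_
      linarith

theorem ADFTRLInvariant.dist_le {hA : IsCommunicationMatrix 𝒢 A} {K : Set (Vec d)}
    (hconv : Convex ℝ K) {h Γ : ℝ} (hh : 0 < h) (hΓ : 0 ≤ Γ)
    {s : ADFTRLState n d} {S : Vec d} (hs : ADFTRLInvariant hA K h Γ s S) {g : Fin n → Vec d}
    (hg : ∀ i, ‖g i‖ ≤ Γ) {v : Vec d} (hv : IsRegMin K h (S + avg g) v) (i : Fin n) :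
    ‖s.x i - v‖ ≤ 2 * (blockSize A * Γ) / h := by
  obtain ⟨z, hz, hzb⟩ := hs.isRegMin i
  have h1 := hz.norm_sub_le hconv hh hv
  have h2 : ‖avg s.acc‖ ≤ s.k * Γ := norm_avg_le (by positivity) hs.norm_acc_le
  have h3 : ‖avg g‖ ≤ Γ := norm_avg_le hΓ hg
  -- To `3CΓ` are added the `k` finished rounds of this block and the current round, where `k + 1 ≤
  -- C`.
  have h4 : ‖z - (S + avg g)‖ ≤ 4 * (blockSize A * Γ) := by
    have : z - (S + avg g) = (z - avg s.cur) - (avg s.acc + avg g) := by rw [← hs.avg_cur]; abel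
    rw [this]
    have h5 : ((s.k : ℝ) + 1) * Γ ≤ blockSize A * Γ := by
      apply mul_le_mul_of_nonneg_right _ hΓ
      exact_mod_cast hs.k_lt
    have := (norm_sub_le (z - avg s.cur) (avg s.acc + avg g)).trans
      (add_le_add hzb ((norm_add_le _ _).trans (add_le_add h2 h3)))
    linarith
  refine h1.trans ?_
  rw [div_le_div_iff₀ (by positivity) hh]
  linarith [mul_le_mul_of_nonneg_right h4 hh.le]

/-- The states of AD-FTRL on linear losses with gradients `g`. -/
noncomputable def adftrlRun (K : Set (Vec d)) (A : Matrix (Fin n) (Fin n) ℝ) (L : ℕ) (θ h : ℝ)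
    (g : ℕ → Fin n → Vec d) : ℕ → ADFTRLState n d
  | 0 => (ADFTRL K A L θ h).start
  | t + 1 => ADFTRLStep K A L θ h (adftrlRun K A L θ h g t) (fun i x => inner ℝ (g t i) x)

theorem adftrlRun_invariant (hA : IsCommunicationMatrix 𝒢 A) (hn : 0 < n) {K : Set (Vec d)}
    (hK : IsCompact K) (hne : K.Nonempty) {h Γ : ℝ} (hh : 0 < h) (hΓ : 0 ≤ Γ)
    (g : ℕ → Fin n → Vec d) {T : ℕ} (hg : ∀ t < T, ∀ i, ‖g t i‖ ≤ Γ) :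
    ∀ t ≤ T, ADFTRLInvariant hA K h Γ
      (adftrlRun K A (blockSize A) (mixingRatio A) h g t) (∑ s ∈ Finset.range t, avg (g s)) := by
  intro t
  induction t with
  | zero => exact fun _ => ADFTRLInvariant.start hA hn hK hne hh hΓ _ _
  | succ t ih =>
    intro ht
    rw [Finset.sum_range_succ]
    exact (ih (by omega)).step hn hK hne hΓ (hg t (by omega))

/-- The regret of AD-FTRL on linear losses, including a penalty for the disagreement of the
learners. -/
theorem adftrlRun_regret (hA : IsCommunicationMatrix 𝒢 A) {K : Set (Vec d)}
    (hK : IsCompact K) (hconv : Convex ℝ K) {h Γ R : ℝ} (hh : 0 < h) (hΓ : 0 ≤ Γ)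
    (hKR : ∀ x ∈ K, ‖x‖ ≤ R) (g : ℕ → Fin n → Vec d) {T : ℕ} (hg : ∀ t < T, ∀ i, ‖g t i‖ ≤ Γ)
    {y : Vec d} (hy : y ∈ K) (i : Fin n) :
    ∑ t ∈ Finset.range T, ∑ j,
      (inner ℝ (g t j) ((adftrlRun K A (blockSize A) (mixingRatio A) h g t).x j - y)
        + Γ / 2 * ‖(adftrlRun K A (blockSize A) (mixingRatio A) h g t).x j
          - (adftrlRun K A (blockSize A) (mixingRatio A) h g t).x i‖)
      ≤ n * (h * R ^ 2 + 4 * (T * blockSize A * Γ ^ 2) / h) := by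
  have hn : 0 < n := i.pos
  have hn' : (0 : ℝ) < n := by exact_mod_cast hn
  have hne : K.Nonempty := ⟨y, hy⟩
  choose v hv using fun t => exists_isRegMin hK hne h (∑ s ∈ Finset.range t, avg (g s))
  set x := fun t => (adftrlRun K A (blockSize A) (mixingRatio A) h g t).x with hx
  have hdist : ∀ t < T, ∀ j, ‖x t j - v (t + 1)‖ ≤ 2 * (blockSize A * Γ) / h := by
    intro t ht j
    have h1 := hv (t + 1)
    rw [Finset.sum_range_succ] at h1
    exact (adftrlRun_invariant hA hn hK hne hh hΓ g hg t ht.le).dist_le hconv hh hΓ (hg t ht) h1 j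
  set δ := 2 * (blockSize A * Γ) / h with hδ
  have hδ0 : 0 ≤ δ := by positivity
  -- Each learner pays `Γδ` for its distance to the leader and `Γ/2 · 2δ` for the disagreement with
  -- learner `i`.
  have hround : ∀ t ∈ Finset.range T, ∑ j, (inner ℝ (g t j) (x t j - y)
      + Γ / 2 * ‖x t j - x t i‖) ≤ n * inner ℝ (avg (g t)) (v (t + 1) - y) + n * (2 * Γ * δ) := by
    intro t ht
    have ht := Finset.mem_range.mp ht
    have h1 : ∑ j, inner ℝ (g t j) (v (t + 1) - y) = n * inner ℝ (avg (g t)) (v (t + 1) - y) := by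
      rw [← sum_inner, avg, inner_smul_left]
      simp only [conj_trivial]
      field_simp
    calc ∑ j, (inner ℝ (g t j) (x t j - y) + Γ / 2 * ‖x t j - x t i‖)
        ≤ ∑ j, (inner ℝ (g t j) (v (t + 1) - y) + 2 * Γ * δ) := by
          refine Finset.sum_le_sum fun j _ => ?_
          have h2 : x t j - y = (x t j - v (t + 1)) + (v (t + 1) - y) := by abel
          have h3 : x t j - x t i = (x t j - v (t + 1)) - (x t i - v (t + 1)) := by abel
          have h4 : inner ℝ (g t j) (x t j - v (t + 1)) ≤ Γ * δ :=
            (real_inner_le_norm _ _).trans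
              (mul_le_mul (hg t ht j) (hdist t ht j) (norm_nonneg _) hΓ)
          have h5 : ‖x t j - x t i‖ ≤ 2 * δ := by
            rw [h3]
            have := (norm_sub_le _ _).trans (add_le_add (hdist t ht j) (hdist t ht i))
            linarith
          rw [h2, inner_add_right]
          have := mul_le_mul_of_nonneg_left h5 (by positivity : 0 ≤ Γ / 2)
          linarith
      _ = _ := by
          rw [Finset.sum_add_distrib, h1]
          simp
  refine (Finset.sum_le_sum hround).trans ?_
  have hbtl := be_the_leader hh.le (fun t => avg (g t)) v T (fun t _ => hv t) hy
  have hyR : h * ‖y‖ ^ 2 ≤ h * R ^ 2 := by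
    have := hKR y hy
    gcongr
  rw [Finset.sum_add_distrib, ← Finset.mul_sum, Finset.sum_const, Finset.card_range, nsmul_eq_mul,
    mul_add]
  refine add_le_add (mul_le_mul_of_nonneg_left (hbtl.trans hyR) hn'.le) (le_of_eq ?_)
  rw [hδ]
  ring

end Pathwise

/-! ### The unit cube -/

section Cube

variable {d : ℕ}

theorem convex_unitCube : Convex ℝ (unitCube d) := by
  intro x hx y hy a b ha hb hab j
  simp only [PiLp.add_apply, PiLp.smul_apply, smul_eq_mul]
  exact convex_Icc (0 : ℝ) 1 (hx j) (hy j) ha hb hab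

theorem isClosed_unitCube : IsClosed (unitCube d) := by
  have : unitCube d = ⋂ j, (fun x : Vec d => x j) ⁻¹' Set.Icc 0 1 := by
    ext x; simp only [unitCube, Set.mem_iInter]; rfl
  rw [this]
  exact isClosed_iInter fun j => isClosed_Icc.preimage (by fun_prop)

theorem isCompact_unitCube : IsCompact (unitCube d) := by
  refine Metric.isCompact_of_isClosed_isBounded isClosed_unitCube ?_
  refine (Metric.isBounded_iff_subset_closedBall 0).mpr ⟨√d, fun x hx => ?_⟩
  rw [mem_closedBall_zero_iff, EuclideanSpace.norm_eq]
  apply Real.sqrt_le_sqrt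
  calc ∑ i, ‖x i‖ ^ 2 ≤ ∑ _i : Fin d, (1 : ℝ) := by
        refine Finset.sum_le_sum fun i _ => ?_
        have := hx i
        rw [Real.norm_eq_abs, sq_abs]
        exact pow_le_one₀ this.1 this.2
    _ = d := by simp

theorem le_supNorm (x : Vec d) (j : Fin d) : x j ≤ supNorm x :=
  (le_abs_self _).trans (norm_le_pi_norm (WithLp.ofLp x) j)

theorem supNorm_le_one {x : Vec d} (hx : x ∈ unitCube d) : supNorm x ≤ 1 := by
  refine (pi_norm_le_iff_of_nonneg zero_le_one).mpr fun j => ?_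
  have := hx j
  rw [Real.norm_eq_abs, abs_of_nonneg this.1]
  exact this.2

theorem queryPoint_mem {xlow x : Vec d} (hxlow : xlow ∈ unitCube d) (hx : x ∈ unitCube d) {z : ℝ}
    (hz : z ∈ Set.Icc (0 : ℝ) 1) : queryPoint xlow x z ∈ unitCube d := by
  rw [queryPoint, add_comm]
  exact convex_unitCube.add_smul_sub_mem hxlow hx ⟨by linarith [hz.1], by linarith [hz.2]⟩

end Cube

/-! ### First-order inequalities for DR-submodular functions -/

section DRSubmodular

variable {d : ℕ} {f : Vec d → ℝ}

/-- Switch on the coordinates of `v` one at a time and telescope the one-coordinate inequalities. -/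
theorem IsDRSubmodular.increment_le (hf : IsDRSubmodular f) {x y v : Vec d} (hx : x ∈ unitCube d)
    (hy : y ∈ unitCube d) (hxv : x + v ∈ unitCube d) (hyv : y + v ∈ unitCube d)
    (hxy : ∀ j, x j ≤ y j) (hv : ∀ j, 0 ≤ v j) : f (y + v) - f y ≤ f (x + v) - f x := by
  classical
  let p : Finset (Fin d) → Vec d := fun S => WithLp.toLp 2 fun i => if i ∈ S then v i else 0
  have hmem : ∀ (x : Vec d), x ∈ unitCube d → x + v ∈ unitCube d → ∀ S, x + p S ∈ unitCube d := by
    intro x hx hxv S j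
    have h1 := hx j; have h2 := hxv j; have h3 := hv j
    simp only [p, PiLp.add_apply, Set.mem_Icc] at h1 h2 ⊢
    split_ifs
    · exact h2
    · simpa using h1
  have hins : ∀ (S : Finset (Fin d)) (j : Fin d), j ∉ S →
      p (insert j S) = p S + EuclideanSpace.single j (v j) := by
    intro S j hj
    ext i
    by_cases hij : i = j
    · subst hij; simp [p, hj]
    · simp [p, hij]
  have key : ∀ S, f (y + p S) - f y ≤ f (x + p S) - f x := by
    intro S
    induction S using Finset.induction_on with
    | empty =>
      have : p ∅ = 0 := by ext i; simp [p]
      simp [this]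
    | insert j S hj ih =>
      have hx1 := hmem x hx hxv (insert j S)
      have hy1 := hmem y hy hyv (insert j S)
      rw [hins S j hj, ← add_assoc] at hx1 hy1 ⊢
      have := hf.diminishing _ (hmem x hx hxv S) _ (hmem y hy hyv S)
        (fun i => by simpa using hxy i) j (v j) (hv j) hx1 hy1
      rw [← add_assoc]
      linarith
  have huniv : p Finset.univ = v := by ext i; simp [p]
  simpa [huniv] using key Finset.univ

theorem hasDerivWithinAt_comp_segment {g a b : Vec d} (s : ℝ)
    (ha : a ∈ unitCube d) (hb : b ∈ unitCube d)
    (hg : HasGradientWithinAt f g (unitCube d) (a + s • (b - a))) :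
    HasDerivWithinAt (fun s : ℝ => f (a + s • (b - a))) (inner ℝ g (b - a)) (Set.Icc 0 1) s := by
  have h1 : HasDerivWithinAt (fun s : ℝ => a + s • (b - a)) ((1 : ℝ) • (b - a)) (Set.Icc 0 1) s :=
    ((hasDerivWithinAt_id s _).smul_const (b - a)).const_add a
  have h2 := hg.hasFDerivWithinAt.comp_hasDerivWithinAt (s := Set.Icc 0 1) s h1
    (fun r hr => convex_unitCube.add_smul_sub_mem ha hb hr)
  simpa using! h2

/-- Cut the segment into `N + 1` equal pieces; no increment exceeds the first, so `f b - f a` is at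
most the difference quotient at `a`. Letting `N → ∞` uses differentiability at `a` only. -/
theorem le_inner_of_increments {g a b : Vec d}
    (ha : a ∈ unitCube d) (hb : b ∈ unitCube d) (hg : HasGradientWithinAt f g (unitCube d) a)
    (hinc : ∀ s r : ℝ, 0 ≤ s → 0 ≤ r → s + r ≤ 1 →
      f (a + (s + r) • (b - a)) - f (a + s • (b - a)) ≤ f (a + r • (b - a)) - f a) :
    f b - f a ≤ inner ℝ g (b - a) := by
  set φ : ℝ → ℝ := fun s => f (a + s • (b - a)) with hφ
  have hφ0 : φ 0 = f a := by simp [hφ]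
  have hφ1 : φ 1 = f b := by simp [hφ]
  have hd : HasDerivWithinAt φ (inner ℝ g (b - a)) (Set.Icc 0 1) 0 :=
    hasDerivWithinAt_comp_segment 0 ha hb (by simpa using hg)
  have hN : ∀ N : ℕ, f b - f a ≤ (N + 1 : ℕ) * (φ (1 / (N + 1 : ℕ)) - φ 0) := by
    intro N
    have hN0 : (0 : ℝ) < (N + 1 : ℕ) := by positivity
    have h1 := Finset.sum_range_sub (fun k : ℕ => φ (k / (N + 1 : ℕ))) (N + 1)
    rw [div_self hN0.ne', Nat.cast_zero, zero_div, hφ1, hφ0] at h1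
    rw [← h1]
    calc _ ≤ ∑ k ∈ Finset.range (N + 1), (φ (1 / (N + 1 : ℕ)) - φ 0) := by
          refine Finset.sum_le_sum fun k hk => ?_
          have hk := Finset.mem_range.mp hk
          have h2 := hinc (k / (N + 1 : ℕ)) (1 / (N + 1 : ℕ)) (by positivity) (by positivity) (by
            rw [← add_div, div_le_one hN0]; exact_mod_cast hk)
          rw [← add_div] at h2
          rw [hφ0]
          push_cast at h2 ⊢
          exact h2
      _ = _ := by rw [Finset.sum_const, Finset.card_range, nsmul_eq_mul]
  have hlim := (hasDerivWithinAt_iff_tendsto_slope.mp hd)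
  have hseq : Filter.Tendsto (fun N : ℕ => (1 : ℝ) / (N + 1 : ℕ)) Filter.atTop
      (nhdsWithin 0 (Set.Icc 0 1 \ {0})) := by
    refine tendsto_nhdsWithin_iff.mpr ⟨?_, Filter.Eventually.of_forall fun N => ?_⟩
    · have := tendsto_one_div_add_atTop_nhds_zero_nat (𝕜 := ℝ)
      simpa using this
    · have hN0 : (0 : ℝ) < (N + 1 : ℕ) := by positivity
      refine ⟨⟨by positivity, ?_⟩, by simp only [Set.mem_singleton_iff]; positivity⟩
      rw [div_le_one hN0]
      push_cast
      linarith [(Nat.cast_nonneg N : (0 : ℝ) ≤ N)]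
  refine ge_of_tendsto (hlim.comp hseq) (Filter.Eventually.of_forall fun N => ?_)
  refine (hN N).trans (le_of_eq ?_)
  simp [slope_def_field]
  ring

theorem IsDRSubmodular.le_inner_of_le (hf : IsDRSubmodular f) {g a b : Vec d}
    (ha : a ∈ unitCube d) (hb : b ∈ unitCube d) (hg : HasGradientWithinAt f g (unitCube d) a)
    (hab : ∀ j, a j ≤ b j) : f b - f a ≤ inner ℝ g (b - a) := by
  refine le_inner_of_increments ha hb hg fun s r hs hr hsr => ?_
  have hm : ∀ s : ℝ, 0 ≤ s → s ≤ 1 → a + s • (b - a) ∈ unitCube d := fun s h0 h1 =>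
    convex_unitCube.add_smul_sub_mem ha hb ⟨h0, h1⟩
  have he : a + (s + r) • (b - a) = a + s • (b - a) + r • (b - a) := by module
  rw [he]
  refine hf.increment_le ha (hm s hs (by linarith)) (hm r hr (by linarith)) ?_ ?_ ?_
  · rw [← he]; exact hm _ (by linarith) hsr
  · intro j
    have := mul_nonneg hs (sub_nonneg.mpr (hab j))
    simpa using this
  · intro j
    have := mul_nonneg hr (sub_nonneg.mpr (hab j))
    simpa using this

theorem IsDRSubmodular.le_inner_of_ge (hf : IsDRSubmodular f) {g a b : Vec d}
    (ha : a ∈ unitCube d) (hb : b ∈ unitCube d) (hg : HasGradientWithinAt f g (unitCube d) a)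
    (hab : ∀ j, b j ≤ a j) : f b - f a ≤ inner ℝ g (b - a) := by
  refine le_inner_of_increments ha hb hg fun s r hs hr hsr => ?_
  have hm : ∀ s : ℝ, 0 ≤ s → s ≤ 1 → a + s • (b - a) ∈ unitCube d := fun s h0 h1 =>
    convex_unitCube.add_smul_sub_mem ha hb ⟨h0, h1⟩
  have e1 : a + (s + r) • (b - a) + r • (a - b) = a + s • (b - a) := by module
  have e2 : a + r • (b - a) + r • (a - b) = a := by module
  have := hf.increment_le (x := a + (s + r) • (b - a)) (y := a + r • (b - a)) (v := r • (a - b))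
    (hm _ (by linarith) hsr) (hm r hr (by linarith)) (by rw [e1]; exact hm s hs (by linarith))
    (by rw [e2]; exact ha) (fun j => ?_) (fun j => ?_)
  · rw [e1, e2] at this; linarith
  · have := mul_nonneg hs (sub_nonneg.mpr (hab j))
    simp only [PiLp.add_apply, PiLp.smul_apply, PiLp.sub_apply, smul_eq_mul]
    linarith
  · have := mul_nonneg hr (sub_nonneg.mpr (hab j))
    simpa using this

/-- The ray from `y` through `p` stays in the cube up to `q = y + (p - y)/m`, because `a ≤ m`. As `p
= (1 - m) y + m q`, concavity along this nonnegative direction and `f q ≥ 0` give the bound.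
Concavity enters through the two tangent inequalities at `p`, whose linear terms cancel. -/
theorem IsDRSubmodular.mul_le_sup (hf : IsDRSubmodular f) (h0 : ∀ x ∈ unitCube d, 0 ≤ f x)
    {a y p g : Vec d} (hy : y ∈ unitCube d) (hp : ∀ j, p j = max (y j) (a j))
    (hpm : p ∈ unitCube d) (hg : HasGradientWithinAt f g (unitCube d) p) {m : ℝ} (hm0 : 0 ≤ m)
    (hm1 : m ≤ 1) (ham : ∀ j, a j ≤ m) : (1 - m) * f y ≤ f p := by
  rcases hm0.eq_or_lt with rfl | hm
  · have : p = y := by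
      ext j; rw [hp, max_eq_left ((ham j).trans (hy j).1)]
    rw [this]; linarith
  have hyp : ∀ j, y j ≤ p j := fun j => by rw [hp]; exact le_max_left _ _
  set q := y + m⁻¹ • (p - y) with hq
  have hqm : q ∈ unitCube d := by
    intro j
    simp only [hq, PiLp.add_apply, PiLp.smul_apply, PiLp.sub_apply, smul_eq_mul]
    have h1 := hy j
    have h2 := sub_nonneg.mpr (hyp j)
    refine ⟨by have := mul_nonneg (inv_nonneg.mpr hm.le) h2; linarith [h1.1], ?_⟩
    rw [hp]
    rcases le_total (y j) (a j) with h | h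
    · rw [max_eq_right h, inv_mul_eq_div, ← le_sub_iff_add_le', div_le_iff₀ hm]
      nlinarith [h1.1, ham j]
    · rw [max_eq_left h]; simpa using h1.2
  have hpq : ∀ j, p j ≤ q j := by
    intro j
    simp only [hq, PiLp.add_apply, PiLp.smul_apply, PiLp.sub_apply, smul_eq_mul]
    have h2 := sub_nonneg.mpr (hyp j)
    have h3 : 1 ≤ m⁻¹ := (one_le_inv₀ hm).mpr hm1
    nlinarith
  have h1 := hf.le_inner_of_ge hpm hy hg hyp
  have h2 := hf.le_inner_of_le hpm hqm hg hpq
  have h3 : (1 - m) * inner ℝ g (y - p) + m * inner ℝ g (q - p) = 0 := by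
    rw [← inner_smul_right, ← inner_smul_right, ← inner_add_right]
    have : (1 - m) • (y - p) + m • (q - p) = 0 := by
      have : m • q = m • y + (p - y) := by rw [hq, smul_add, smul_smul, mul_inv_cancel₀ hm.ne', one_smul]
      rw [smul_sub m q, this]
      module
    rw [this, inner_zero_right]
  have h4 := mul_le_mul_of_nonneg_left h1 (sub_nonneg.mpr hm1)
  have h5 := mul_le_mul_of_nonneg_left h2 hm.le
  have h6 := mul_nonneg hm.le (h0 q hqm)
  linarith

theorem IsDRSubmodular.gradient_bound (hf : IsDRSubmodular f) (h0 : ∀ x ∈ unitCube d, 0 ≤ f x)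
    {F : Vec d → Vec d} (hF : ∀ x ∈ unitCube d, HasGradientWithinAt f (F x) (unitCube d) x)
    {a y : Vec d} (ha : a ∈ unitCube d) (hy : y ∈ unitCube d) {m : ℝ} (hm0 : 0 ≤ m)
    (hm1 : m ≤ 1) (ham : ∀ j, a j ≤ m) : (1 - m) * f y - 2 * f a ≤ inner ℝ (F a) (y - a) := by
  set p : Vec d := WithLp.toLp 2 fun j => max (y j) (a j) with hp
  set q : Vec d := WithLp.toLp 2 fun j => min (y j) (a j) with hq
  have hpm : p ∈ unitCube d := fun j =>
    ⟨(hy j).1.trans (le_max_left _ _), max_le (hy j).2 (ha j).2⟩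
  have hqm : q ∈ unitCube d := fun j =>
    ⟨le_min (hy j).1 (ha j).1, (min_le_left _ _).trans (hy j).2⟩
  have h1 := hf.mul_le_sup h0 hy (p := p) (fun j => rfl) hpm (hF p hpm) hm0 hm1 ham
  have h2 := hf.le_inner_of_le ha hpm (hF a ha) (fun j => le_max_right _ _)
  have h3 := hf.le_inner_of_ge ha hqm (hF a ha) (fun j => min_le_right _ _)
  have h4 : inner ℝ (F a) (y - a) = inner ℝ (F a) (p - a) + inner ℝ (F a) (q - a) := by
    rw [← inner_add_right]
    congr 1
    ext j
    simp only [hp, hq, PiLp.sub_apply, PiLp.add_apply]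
    linarith [max_add_min (y j) (a j)]
  have h5 := h0 q hqm
  linarith

end DRSubmodular

/-! ### The sampling law on `[0,1]` -/

section BoostingLaw

theorem one_sub_half_pos {z : ℝ} (hz : z ∈ Set.Icc (0 : ℝ) 1) : 0 < 1 - z / 2 := by
  linarith [hz.2]

theorem hasDerivAt_one_sub_half (z : ℝ) : HasDerivAt (fun z : ℝ => 1 - z / 2) (-(1 / 2)) z := by
  simpa using ((hasDerivAt_id z).div_const 2).const_sub 1

theorem continuousOn_boosting_density :
    ContinuousOn (fun u : ℝ => ((1 - u / 2) ^ 3)⁻¹ / 3) (Set.Icc 0 1) := by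
  refine ContinuousOn.div_const (ContinuousOn.inv₀ (by fun_prop) fun z hz => ?_) _
  exact (pow_pos (one_sub_half_pos hz) 3).ne'

theorem boosting_density_nonneg {u : ℝ} (hu : u ∈ Set.Icc (0 : ℝ) 1) :
    0 ≤ ((1 - u / 2) ^ 3)⁻¹ / 3 := by
  have := one_sub_half_pos hu
  positivity

instance : IsProbabilityMeasure boostingLaw := by
  constructor
  have hint : IntegrableOn (fun u : ℝ => ((1 - u / 2) ^ 3)⁻¹ / 3) (Set.Icc 0 1) :=
    continuousOn_boosting_density.integrableOn_Icc
  rw [boostingLaw, withDensity_apply _ MeasurableSet.univ, Measure.restrict_univ,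
    ← ofReal_integral_eq_lintegral_ofReal hint
      ((ae_restrict_iff' measurableSet_Icc).mpr (.of_forall fun u hu => boosting_density_nonneg hu)),
    integral_Icc_eq_integral_Ioc, ← intervalIntegral.integral_of_le zero_le_one]
  have hprim : ∀ z ∈ Set.uIcc (0 : ℝ) 1, HasDerivAt (fun z : ℝ => ((1 - z / 2) ^ 2)⁻¹ / 3)
      (((1 - z / 2) ^ 3)⁻¹ / 3) z := by
    intro z hz
    rw [Set.uIcc_of_le zero_le_one] at hz
    have hp := one_sub_half_pos hz
    convert! (((hasDerivAt_one_sub_half z).fun_pow 2).fun_inv (by positivity)).div_const 3 using 1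
    generalize 1 - z / 2 = u at hp ⊢
    field_simp
    ring
  rw [intervalIntegral.integral_eq_sub_of_hasDerivAt hprim]
  · norm_num
  · exact (continuousOn_boosting_density.mono (by rw [Set.uIcc_of_le zero_le_one])).intervalIntegrable

theorem ae_mem_Icc_boostingLaw : ∀ᵐ z ∂boostingLaw, z ∈ Set.Icc (0 : ℝ) 1 :=
  (withDensity_absolutelyContinuous _ _).ae_le (ae_restrict_mem measurableSet_Icc)

theorem integral_boostingLaw (F : ℝ → ℝ) :
    ∫ z, F z ∂boostingLaw = ∫ z in (0 : ℝ)..1, ((1 - z / 2) ^ 3)⁻¹ / 3 * F z := by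
  rw [intervalIntegral.integral_of_le zero_le_one, ← integral_Icc_eq_integral_Ioc, boostingLaw,
    integral_withDensity_eq_integral_toReal_smul (by fun_prop) (.of_forall fun _ => by simp)]
  refine setIntegral_congr_fun measurableSet_Icc fun z hz => ?_
  simp only [smul_eq_mul]
  rw [ENNReal.toReal_ofReal (boosting_density_nonneg hz)]

end BoostingLaw

/-! ### The boosted gradient in expectation over `z` -/

section Boosting

variable {d : ℕ} {f : Vec d → ℝ}

theorem queryPoint_eq (xlow x : Vec d) (z : ℝ) :
    queryPoint xlow x z = xlow + (z / 2) • (x - xlow) := by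
  rw [queryPoint, add_comm]

theorem one_sub_queryPoint_bound {xlow x : Vec d}
    (hx : x ∈ unitCube d) {z : ℝ} (hz : z ∈ Set.Icc (0 : ℝ) 1) (j : Fin d) :
    queryPoint xlow x z j ≤ 1 - (1 - z / 2) * (1 - supNorm xlow) := by
  have h1 := le_supNorm xlow j
  have h2 := (hx j).2
  have h3 := one_sub_half_pos hz
  have h4 := mul_le_mul_of_nonneg_left h1 h3.le
  have h5 := mul_le_mul_of_nonneg_left h2 (by linarith [hz.1] : 0 ≤ z / 2)
  simp only [queryPoint, PiLp.add_apply, PiLp.smul_apply, PiLp.sub_apply, smul_eq_mul]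
  linarith

theorem measurable_queryPoint (xlow x : Vec d) : Measurable (queryPoint xlow x) := by
  unfold queryPoint
  fun_prop

/-- The gradient of the boosted function at `x` gives a `(1 - ν)/4`-approximation, up to the value
of `f` at the midpoint of `x` and `xlow`. -/
theorem boosting_bound (hf : IsDRSubmodular f) (h0 : ∀ x ∈ unitCube d, 0 ≤ f x)
    {F : Vec d → Vec d} (hFm : Measurable F) {G : ℝ} (hFG : ∀ x ∈ unitCube d, ‖F x‖ ≤ G)
    (hF : ∀ x ∈ unitCube d, HasGradientWithinAt f (F x) (unitCube d) x)
    {x y xlow : Vec d} (hx : x ∈ unitCube d) (hy : y ∈ unitCube d) (hxlow : xlow ∈ unitCube d) :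
    (1 - supNorm xlow) / 4 * f y - f ((1 / 2 : ℝ) • (x + xlow))
      ≤ ∫ z, inner ℝ ((3 / 8 : ℝ) • F (queryPoint xlow x z)) (y - x) ∂boostingLaw := by
  set ν := supNorm xlow with hν
  have hν0 : 0 ≤ ν := norm_nonneg _
  have hν1 : ν ≤ 1 := supNorm_le_one hxlow
  have hq : ∀ z ∈ Set.Icc (0 : ℝ) 1, queryPoint xlow x z ∈ unitCube d := fun z hz =>
    queryPoint_mem hxlow hx hz
  set φ : ℝ → ℝ := fun z => f (queryPoint xlow x z) with hφ
  set φ' : ℝ → ℝ := fun z => inner ℝ (F (queryPoint xlow x z)) ((1 / 2 : ℝ) • (x - xlow)) with hφ'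
  have hφd : ∀ z ∈ Set.Icc (0 : ℝ) 1, HasDerivWithinAt φ (φ' z) (Set.Icc 0 1) z := by
    intro z hz
    have h1 : HasDerivWithinAt (queryPoint xlow x) ((1 / 2 : ℝ) • (x - xlow)) (Set.Icc 0 1) z := by
      have := (((hasDerivWithinAt_id z (Set.Icc 0 1)).div_const 2).smul_const (x - xlow)).const_add
        xlow
      refine this.congr_of_mem (fun z _ => queryPoint_eq xlow x z) hz
    have h2 := (hF _ (hq z hz)).hasFDerivWithinAt.comp_hasDerivWithinAt z h1 hq
    exact h2
  -- An antiderivative of the lower bound for the integrand. The density is chosen so that the terms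
  -- in `φ` and `φ'` combine into the derivative of `(1 - z/2)⁻² φ`; `Ψ 1 - Ψ 0` is the left-hand
  -- side of the claim plus `φ 0 / 4 ≥ 0`.
  set Ψ : ℝ → ℝ := fun z => (1 - ν) / 4 * f y * (1 - z / 2)⁻¹ - 1 / 4 * (((1 - z / 2) ^ 2)⁻¹ * φ z)
    with hΨ
  have hΨd : ∀ z ∈ Set.Icc (0 : ℝ) 1, HasDerivWithinAt Ψ ((1 - ν) / 8 * f y * ((1 - z / 2) ^ 2)⁻¹
      - 1 / 4 * (((1 - z / 2) ^ 3)⁻¹ * φ z + ((1 - z / 2) ^ 2)⁻¹ * φ' z)) (Set.Icc 0 1) z := by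
    intro z hz
    have hp := one_sub_half_pos hz
    have h1 := (((hasDerivAt_one_sub_half z).fun_inv hp.ne').hasDerivWithinAt
      (s := Set.Icc 0 1)).const_mul ((1 - ν) / 4 * f y)
    have h2 := ((((hasDerivAt_one_sub_half z).fun_pow 2).fun_inv
      (by positivity)).hasDerivWithinAt (s := Set.Icc 0 1)).mul (hφd z hz)
    convert! h1.sub (h2.const_mul (1 / 4)) using 1
    generalize 1 - z / 2 = u at hp ⊢
    field_simp
    ring
  have hcont : ContinuousOn Ψ (Set.Icc 0 1) := fun z hz => (hΨd z hz).continuousWithinAt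
  rw [integral_boostingLaw]
  -- The gradient of `f` need not be continuous, so an inequality form of the fundamental theorem is
  -- used: it requires integrability only of the function dominating `Ψ'`.
  have key := intervalIntegral.sub_le_integral_of_hasDeriv_right_of_le (g := Ψ)
    (φ := fun z => ((1 - z / 2) ^ 3)⁻¹ / 3 *
      inner ℝ ((3 / 8 : ℝ) • F (queryPoint xlow x z)) (y - x)) zero_le_one hcont
    (fun z hz => ((hΨd z ⟨hz.1.le, hz.2.le⟩).hasDerivAt (Icc_mem_nhds hz.1 hz.2)).hasDerivWithinAt)
    ?_ ?_
  · refine le_trans ?_ key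
    have e1 : queryPoint xlow x 1 = (1 / 2 : ℝ) • (x + xlow) := by
      rw [queryPoint]; module
    have e0 : 0 ≤ φ 0 := h0 _ (hq 0 (by simp))
    simp only [hΨ, hφ, e1] at e0 ⊢
    norm_num
    linarith
  · refine Measure.integrableOn_of_bounded (M := 8 / 3 * (3 / 8 * G * ‖y - x‖)) (by simp) ?_ ?_
    · exact (Measurable.aestronglyMeasurable (by
        have := hFm.comp (measurable_queryPoint xlow x)
        have h2 : Measurable fun z : ℝ => ((1 - z / 2) ^ 3)⁻¹ / 3 := by fun_prop
        exact h2.mul ((this.const_smul (3 / 8 : ℝ)).inner_const)))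
    · refine (ae_restrict_iff' measurableSet_Icc).mpr (.of_forall fun z hz => ?_)
      have hp := one_sub_half_pos hz
      rw [norm_mul, Real.norm_of_nonneg (boosting_density_nonneg hz)]
      have h1 : ‖inner ℝ ((3 / 8 : ℝ) • F (queryPoint xlow x z)) (y - x)‖
          ≤ 3 / 8 * G * ‖y - x‖ := by
        refine (norm_inner_le_norm _ _).trans ?_
        rw [norm_smul, Real.norm_of_nonneg (by norm_num)]
        have := hFG _ (hq z hz)
        gcongr
      have h2 : ((1 - z / 2) ^ 3)⁻¹ / 3 ≤ 8 / 3 := by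
        have h3 : (1 / 2 : ℝ) ^ 3 ≤ (1 - z / 2) ^ 3 :=
          pow_le_pow_left₀ (by norm_num) (by linarith [hz.2]) 3
        have h4 := inv_anti₀ (by norm_num) h3
        norm_num at h4 ⊢
        linarith
      exact mul_le_mul h2 h1 (norm_nonneg _) (by norm_num)
  · intro z hz
    have hz' : z ∈ Set.Icc (0 : ℝ) 1 := ⟨hz.1.le, hz.2.le⟩
    have hp := one_sub_half_pos hz'
    have hp1 : 1 - z / 2 ≤ 1 := by linarith [hz.1]
    have hm := mul_nonneg hp.le (sub_nonneg.mpr hν1)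
    have hm1 : (1 - z / 2) * (1 - ν) ≤ 1 := mul_le_one₀ hp1 (by linarith) (by linarith)
    have hb := hf.gradient_bound h0 hF (hq z hz') hy (m := 1 - (1 - z / 2) * (1 - ν))
      (by linarith) (by linarith) (one_sub_queryPoint_bound hx hz')
    -- The first part is handled by `gradient_bound` at the query point; the second is along the
    -- segment, where the gradient gives `φ'`.
    have e : y - x = (y - queryPoint xlow x z) - (2 * (1 - z / 2)) • ((1 / 2 : ℝ) • (x - xlow)) := by
      rw [queryPoint]; module
    have e2 : inner ℝ (F (queryPoint xlow x z)) (y - x)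
        = inner ℝ (F (queryPoint xlow x z)) (y - queryPoint xlow x z)
          - 2 * (1 - z / 2) * φ' z := by
      rw [e, inner_sub_right, inner_smul_right, hφ']
    rw [inner_smul_left, e2]
    simp only [conj_trivial]
    have hw : 0 ≤ ((1 - z / 2) ^ 3)⁻¹ / 8 := by positivity
    have := mul_le_mul_of_nonneg_left hb hw
    calc _ = ((1 - z / 2) ^ 3)⁻¹ / 8 * ((1 - (1 - (1 - z / 2) * (1 - ν))) * f y
            - 2 * f (queryPoint xlow x z)) - ((1 - z / 2) ^ 3)⁻¹ / 8 * (2 * (1 - z / 2) * φ' z) := by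
          rw [hφ]
          field_simp
          ring
      _ ≤ ((1 - z / 2) ^ 3)⁻¹ / 8 * inner ℝ (F (queryPoint xlow x z)) (y - queryPoint xlow x z)
            - ((1 - z / 2) ^ 3)⁻¹ / 8 * (2 * (1 - z / 2) * φ' z) := by linarith
      _ = _ := by ring

end Boosting

/-! ### The random run of the reduction: identification and measurability -/

section ReductionRun

variable {n d : ℕ} {Ξ : Type*}

/-- The gradient of the loss passed to learner `i` at round `t`. -/
noncomputable def lossGrad (D : DOCOAlgorithm n d) (xlow : Vec d)
    (o : ℕ → Fin n → Vec d → Ξ → Vec d) (w : ℕ → Ξ × (Fin n → ℝ)) (t : ℕ) (i : Fin n) : Vec d :=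
  -((3 / 8 : ℝ) • o t i (queryPoint xlow (D.decision (reductionState D xlow o w t) i) ((w t).2 i))
    (w t).1)

theorem reductionState_congr (D : DOCOAlgorithm n d) (xlow : Vec d)
    (o : ℕ → Fin n → Vec d → Ξ → Vec d) {w w' : ℕ → Ξ × (Fin n → ℝ)} :
    ∀ t, (∀ s < t, w s = w' s) → reductionState D xlow o w t = reductionState D xlow o w' t
  | 0, _ => rfl
  | t + 1, h => by
    simp only [reductionState]
    rw [reductionState_congr D xlow o t fun s hs => h s (by omega), h t (by omega)]

variable (K : Set (Vec d)) (A : Matrix (Fin n) (Fin n) ℝ) (L : ℕ) (θ h : ℝ)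

theorem reductionState_eq_adftrlRun (xlow : Vec d)
    (o : ℕ → Fin n → Vec d → Ξ → Vec d) (w : ℕ → Ξ × (Fin n → ℝ)) :
    ∀ t, reductionState (ADFTRL K A L θ h) xlow o w t
      = adftrlRun K A L θ h (lossGrad (ADFTRL K A L θ h) xlow o w) t
  | 0 => rfl
  | t + 1 => by
    rw [adftrlRun, ← reductionState_eq_adftrlRun xlow o w t]
    rfl

theorem adftrlRun_mem {K : Set (Vec d)} (hK : IsCompact K) (hne : K.Nonempty)
    (g : ℕ → Fin n → Vec d) : ∀ t i, (adftrlRun K A L θ h g t).x i ∈ K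
  | 0, i => (isRegMin_argminOn_norm hK hne (zero_le_one' ℝ)).1
  | t + 1, i => by
    rw [adftrlRun, ADFTRLStep]
    dsimp only
    split_ifs
    · exact adftrlRun_mem hK hne g t i
    · exact (isRegMin_argminOn hK hne h _).1

/-- A random state of AD-FTRL all of whose components are measurable. -/
structure MeasurableState {Ω : Type*} [MeasurableSpace Ω] (s : Ω → ADFTRLState n d) : Prop where
  k_eq : ∃ k, ∀ ω, (s ω).k = k
  x : ∀ i, Measurable fun ω => (s ω).x i
  cur : ∀ i, Measurable fun ω => (s ω).cur i
  prev : ∀ i, Measurable fun ω => (s ω).prev i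
  acc : ∀ i, Measurable fun ω => (s ω).acc i

theorem MeasurableState.step {Ω : Type*} [MeasurableSpace Ω] {K : Set (Vec d)} (hK : IsCompact K)
    (hne : K.Nonempty) (hconv : Convex ℝ K) {h : ℝ} (hh : 0 < h) {s : Ω → ADFTRLState n d}
    (hs : MeasurableState s) {g : Ω → Fin n → Vec d} (hg : ∀ i, Measurable fun ω => g ω i) :
    MeasurableState fun ω => ADFTRLStep K A L θ h (s ω) (fun i x => inner ℝ (g ω i) x) := by
  obtain ⟨k, hk⟩ := hs.k_eq
  have hnext : ∀ i, Measurable fun ω =>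
      (1 + θ) • (∑ j, A i j • (s ω).cur j) - θ • (s ω).prev i := by
    intro i
    have h1 := hs.cur
    have h2 := hs.prev i
    fun_prop
  have hacc : ∀ i, Measurable fun ω => (s ω).acc i + g ω i := fun i => (hs.acc i).add (hg i)
  -- The round counter does not depend on `ω`, so all paths take the same branch.
  simp only [ADFTRLStep, gradient_inner_left, hk]
  split_ifs
  · exact ⟨⟨k + 1, fun _ => rfl⟩, hs.x, hnext, hs.cur, hacc⟩
  · exact ⟨⟨0, fun _ => rfl⟩,
      fun i => (continuous_argminOn hK hne hconv hh).measurable.comp (hnext i),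
      fun i => (hnext i).add (hacc i), fun i => (hs.cur i).add (hacc i), fun _ => measurable_const⟩

theorem measurableState_reductionState [MeasurableSpace Ξ] {K : Set (Vec d)} (hK : IsCompact K)
    (hne : K.Nonempty) (hconv : Convex ℝ K) {h : ℝ} (hh : 0 < h) (xlow : Vec d)
    (o : ℕ → Fin n → Vec d → Ξ → Vec d) {T : ℕ}
    (ho : ∀ t < T, ∀ i, Measurable fun p : Vec d × Ξ => o t i p.1 p.2) :
    ∀ t ≤ T, MeasurableState (Ω := ℕ → Ξ × (Fin n → ℝ))
      fun w => reductionState (ADFTRL K A L θ h) xlow o w t := by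
  intro t
  induction t with
  | zero =>
    intro _
    exact ⟨⟨0, fun _ => rfl⟩, fun _ => measurable_const, fun _ => measurable_const,
      fun _ => measurable_const, fun _ => measurable_const⟩
  | succ t ih =>
    intro ht
    have hs := ih (by omega)
    have hg : ∀ i, Measurable fun w : ℕ → Ξ × (Fin n → ℝ) =>
        lossGrad (ADFTRL K A L θ h) xlow o w t i := by
      intro i
      have hx := hs.x i
      have hz : Measurable fun w : ℕ → Ξ × (Fin n → ℝ) => (w t).2 i :=
        (measurable_pi_apply i).comp (measurable_snd.comp (measurable_pi_apply t))
      have hξ : Measurable fun w : ℕ → Ξ × (Fin n → ℝ) => (w t).1 :=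
        measurable_fst.comp (measurable_pi_apply t)
      have hq := ((hz.div_const 2).smul (hx.sub_const xlow)).add_const xlow
      exact (((ho t (by omega) i).comp (hq.prodMk hξ)).const_smul (3 / 8 : ℝ)).neg
    exact hs.step A L θ hK hne hconv hh hg

end ReductionRun

/-! ### Independence of the past and the current round -/

section Independence

variable {n d : ℕ} {Ξ Ω : Type*} [MeasurableSpace Ξ] [MeasurableSpace Ω] {P : Measure Ω}

/-- A function of the first `t` rounds is independent of round `t`. -/
theorem indepFun_history {E F : Type*} [MeasurableSpace E] [MeasurableSpace F] [Nonempty Ω]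
    {T : ℕ} {W : ℕ → Ω → E} (hW : ∀ t < T, AEMeasurable (W t) P)
    (hind : iIndepFun (fun t : Fin T => W t) P) {t : ℕ} (ht : t < T) {Φ : (ℕ → E) → F}
    (hΦ : Measurable Φ) (hdep : ∀ w w' : ℕ → E, (∀ s < t, w s = w' s) → Φ w = Φ w') :
    AEMeasurable (fun ω => Φ fun s => W s ω) P ∧
      IndepFun (fun ω => Φ fun s => W s ω) (W t) P := by
  classical
  obtain ⟨ω₀⟩ := ‹Nonempty Ω›
  let S : Finset (Fin T) := Finset.univ.filter fun s => (s : ℕ) < t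
  -- Rounds from `t` on get an arbitrary constant value, which `hdep` makes irrelevant; thus `Φ`
  -- factors through finitely many rounds, as `indepFun_finset₀` requires.
  let ext : (S → E) → ℕ → E := fun η s =>
    if hs : s < t then η ⟨⟨s, hs.trans ht⟩, by simp [S, hs]⟩ else W 0 ω₀
  have hext : Measurable ext := by
    refine measurable_pi_lambda _ fun s => ?_
    by_cases hs : s < t
    · simp only [ext, hs, dif_pos]
      exact measurable_pi_apply _
    · simp only [ext, hs, dif_neg, not_false_eq_true]
      exact measurable_const
  have hfac : (fun ω => Φ fun s => W s ω) = (Φ ∘ ext) ∘ fun ω (s : S) => W s ω := by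
    ext1 ω
    refine hdep _ _ fun s hs => ?_
    simp [ext, hs]
  have hind' := hind.indepFun_finset₀ S {⟨t, ht⟩} (by simp [S]) fun s => hW s s.2
  rw [hfac]
  constructor
  · exact (hΦ.comp hext).comp_aemeasurable
      (aemeasurable_pi_lambda _ fun s => hW s s.1.2)
  · exact hind'.comp (hΦ.comp hext)
      (measurable_pi_apply (⟨⟨t, ht⟩, by simp⟩ : ({⟨t, ht⟩} : Finset (Fin T))))

end Independence

/-! ### Stochastic oracles at a fixed decision -/

section Oracle

variable {d : ℕ} {Ξ : Type*} [MeasurableSpace Ξ] {μ : Measure Ξ} {G : ℝ} {f : Vec d → ℝ}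
  {o : Vec d → Ξ → Vec d}

theorem IsStochasticGradient.measurable_mean [SFinite μ] (ho : IsStochasticGradient μ G f o) :
    Measurable fun x => ∫ ξ, o x ξ ∂μ :=
  (ho.measurable.stronglyMeasurable.integral_prod_right (ν := μ)).measurable

theorem IsStochasticGradient.norm_mean_le [IsProbabilityMeasure μ]
    (ho : IsStochasticGradient μ G f o) {x : Vec d} (hx : x ∈ unitCube d) :
    ‖∫ ξ, o x ξ ∂μ‖ ≤ G := by
  simpa using norm_integral_le_of_norm_le_const (ho.bounded x hx)

theorem IsStochasticGradient.integrable [IsFiniteMeasure μ]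
    (ho : IsStochasticGradient μ G f o) {x : Vec d} (hx : x ∈ unitCube d) :
    Integrable (o x) μ :=
  .of_bound (ho.measurable.comp measurable_prodMk_left).aestronglyMeasurable G (ho.bounded x hx)

theorem IsStochasticGradient.lipschitz [IsProbabilityMeasure μ]
    (ho : IsStochasticGradient μ G f o) {x y : Vec d} (hx : x ∈ unitCube d)
    (hy : y ∈ unitCube d) : f x - f y ≤ G * ‖x - y‖ := by
  have h := convex_unitCube.norm_image_sub_le_of_norm_hasFDerivWithin_le
    (f := f) (C := G) (fun x hx => (ho.unbiased x hx).hasFDerivWithinAt)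
    (fun x hx => by
      rw [LinearIsometryEquiv.norm_map]
      exact ho.norm_mean_le hx) hy hx
  exact (le_abs_self _).trans h

theorem measurable_queryPoint_prod (xlow : Vec d) :
    Measurable fun p : Vec d × (Ξ × ℝ) => queryPoint xlow p.1 p.2.2 := by
  unfold queryPoint
  fun_prop

theorem IsStochasticGradient.measurable_query (ho : IsStochasticGradient μ G f o) (xlow : Vec d) :
    Measurable fun p : Vec d × (Ξ × ℝ) => o (queryPoint xlow p.1 p.2.2) p.2.1 :=
  ho.measurable.comp ((measurable_queryPoint_prod xlow).prodMk (measurable_fst.comp measurable_snd))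

theorem IsStochasticGradient.ae_norm_query_le [SFinite μ] (ho : IsStochasticGradient μ G f o)
    {xlow x : Vec d} (hxlow : xlow ∈ unitCube d) (hx : x ∈ unitCube d) :
    ∀ᵐ p ∂μ.prod boostingLaw, ‖o (queryPoint xlow x p.2) p.1‖ ≤ G := by
  have hm : Measurable fun p : Ξ × ℝ => o (queryPoint xlow x p.2) p.1 :=
    (ho.measurable_query xlow).comp measurable_prodMk_left
  have hS : MeasurableSet {p : Ξ × ℝ | ‖o (queryPoint xlow x p.2) p.1‖ ≤ G} :=
    measurableSet_le hm.norm measurable_const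
  -- The exceptional set of `ξ` depends on the query, so `z` has to be fixed first.
  rw [Measure.ae_prod_iff_ae_ae hS, Measure.ae_ae_comm hS]
  filter_upwards [ae_mem_Icc_boostingLaw] with z hz
  exact ho.bounded _ (queryPoint_mem hxlow hx hz)

theorem IsStochasticGradient.boosting_bound [IsProbabilityMeasure μ]
    (ho : IsStochasticGradient μ G f o) (hf : IsDRSubmodular f)
    (h0 : ∀ x ∈ unitCube d, 0 ≤ f x) {x y xlow : Vec d} (hx : x ∈ unitCube d)
    (hy : y ∈ unitCube d) (hxlow : xlow ∈ unitCube d) :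
    (1 - supNorm xlow) / 4 * f y - f ((1 / 2 : ℝ) • (x + xlow))
      ≤ ∫ p, inner ℝ ((3 / 8 : ℝ) • o (queryPoint xlow x p.2) p.1) (y - x)
        ∂μ.prod boostingLaw := by
  have hm : Measurable fun p : Ξ × ℝ => o (queryPoint xlow x p.2) p.1 :=
    (ho.measurable_query xlow).comp measurable_prodMk_left
  have hint : Integrable (fun p : Ξ × ℝ =>
      inner ℝ ((3 / 8 : ℝ) • o (queryPoint xlow x p.2) p.1) (y - x)) (μ.prod boostingLaw) :=
    ((Integrable.of_bound hm.aestronglyMeasurable G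
      (ho.ae_norm_query_le hxlow hx)).smul (3 / 8 : ℝ)).inner_const _
  refine (_root_.boosting_bound hf h0 ho.measurable_mean (fun x hx => ho.norm_mean_le hx)
    ho.unbiased hx hy hxlow).trans (le_of_eq ?_)
  rw [integral_prod_symm _ hint]
  refine integral_congr_ae ?_
  filter_upwards [ae_mem_Icc_boostingLaw] with z hz
  have hi := ho.integrable (queryPoint_mem hxlow hx hz)
  simp only [inner_smul_left, integral_const_mul]
  rw [real_inner_comm, ← integral_inner hi]
  simp only [real_inner_comm]

/-- Outside the cube `f` may fail to be measurable, so it is replaced there by zero. -/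
theorem ContinuousOn.integrable_comp_of_mem {Ω : Type*} [MeasurableSpace Ω] {P : Measure Ω}
    [IsFiniteMeasure P] (hf : ContinuousOn f (unitCube d)) {X : Ω → Vec d} (hX : AEMeasurable X P)
    (hmem : ∀ ω, X ω ∈ unitCube d) : Integrable (fun ω => f (X ω)) P := by
  classical
  obtain ⟨c, hc⟩ := isCompact_unitCube.exists_bound_of_continuousOn hf
  have hm : Measurable ((unitCube d).piecewise f fun _ => 0) :=
    hf.measurable_piecewise continuousOn_const isClosed_unitCube.measurableSet
  have heq : (fun ω => f (X ω)) = fun ω => (unitCube d).piecewise f (fun _ => 0) (X ω) := by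
    ext1 ω
    rw [Set.piecewise_eq_of_mem _ _ _ (hmem ω)]
  refine .of_bound ?_ c (.of_forall fun ω => hc _ (hmem ω))
  rw [heq]
  exact (hm.comp_aemeasurable hX).aestronglyMeasurable

theorem half_add_mem {x xlow : Vec d} (hx : x ∈ unitCube d) (hxlow : xlow ∈ unitCube d) :
    (1 / 2 : ℝ) • (x + xlow) ∈ unitCube d := by
  rw [smul_add]
  exact convex_unitCube hx hxlow (by norm_num) (by norm_num) (by norm_num)

end Oracle

/-! ### One round with a random decision -/

section Round

variable {d n : ℕ} {Ξ Ω : Type*} [MeasurableSpace Ξ] [MeasurableSpace Ω] {P : Measure Ω}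
  [IsProbabilityMeasure P] {μ : Measure Ξ} [IsProbabilityMeasure μ] {G : ℝ} {f : Vec d → ℝ}
  {o : Vec d → Ξ → Vec d} {X : Ω → Vec d} {W : Ω → Ξ × (Fin n → ℝ)}

theorem map_prodMk_sample (hX : AEMeasurable X P)
    (hW : HasLaw W (μ.prod (Measure.pi fun _ : Fin n => boostingLaw)) P) (hind : IndepFun X W P)
    (j : Fin n) :
    AEMeasurable (fun ω => (X ω, ((W ω).1, (W ω).2 j))) P ∧
    P.map (fun ω => (X ω, ((W ω).1, (W ω).2 j))) = (P.map X).prod (μ.prod boostingLaw) := by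
  have hψ : MeasurePreserving (Prod.map id (Function.eval j) : Ξ × (Fin n → ℝ) → Ξ × ℝ)
      (μ.prod (Measure.pi fun _ : Fin n => boostingLaw)) (μ.prod boostingLaw) :=
    (MeasurePreserving.id μ).prod (measurePreserving_eval (fun _ : Fin n => boostingLaw) j)
  have hi := hind.comp measurable_id hψ.measurable
  have hW' : AEMeasurable (Prod.map id (Function.eval j) ∘ W) P :=
    hψ.measurable.comp_aemeasurable hW.aemeasurable
  have h := (indepFun_iff_map_prod_eq_prod_map_map (by exact hX) hW').mp hi
  refine ⟨hX.prodMk hW', ?_⟩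
  have hmap : P.map (Prod.map id (Function.eval j) ∘ W) = μ.prod boostingLaw := by
    rw [← AEMeasurable.map_map_of_aemeasurable hψ.measurable.aemeasurable hW.aemeasurable,
      hW.map_eq, hψ.map_eq]
  rw [hmap] at h
  exact h

theorem IsStochasticGradient.ae_sample_norm_le (ho : IsStochasticGradient μ G f o)
    (hX : AEMeasurable X P) (hXm : ∀ ω, X ω ∈ unitCube d)
    (hW : HasLaw W (μ.prod (Measure.pi fun _ : Fin n => boostingLaw)) P) (hind : IndepFun X W P)
    {xlow : Vec d} (hxlow : xlow ∈ unitCube d) (j : Fin n) :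
    ∀ᵐ ω ∂P, ‖o (queryPoint xlow (X ω) ((W ω).2 j)) (W ω).1‖ ≤ G := by
  obtain ⟨hm, hlaw⟩ := map_prodMk_sample hX hW hind j
  have hS : MeasurableSet {p : Vec d × (Ξ × ℝ) | ‖o (queryPoint xlow p.1 p.2.2) p.2.1‖ ≤ G} :=
    measurableSet_le (ho.measurable_query xlow).norm measurable_const
  have h : ∀ᵐ p ∂P.map (fun ω => (X ω, ((W ω).1, (W ω).2 j))),
      ‖o (queryPoint xlow p.1 p.2.2) p.2.1‖ ≤ G := by
    rw [hlaw, Measure.ae_prod_iff_ae_ae hS]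
    have : ∀ᵐ x ∂P.map X, x ∈ unitCube d :=
      (ae_map_iff hX isClosed_unitCube.measurableSet).mpr (.of_forall hXm)
    filter_upwards [this] with x hx
    exact ho.ae_norm_query_le hxlow hx
  exact (ae_map_iff hm hS).mp h

theorem exists_norm_sub_le_of_mem_unitCube (y : Vec d) :
    ∃ c, ∀ x ∈ unitCube d, ‖x - y‖ ≤ c :=
  isCompact_unitCube.exists_bound_of_continuousOn (by fun_prop)

/-- The expected linear loss of a round dominates the expected reward gap, when the decision is
independent of the randomness of the round. -/
theorem IsStochasticGradient.integral_sample_le (ho : IsStochasticGradient μ G f o)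
    (hf : IsDRSubmodular f) (h0 : ∀ x ∈ unitCube d, 0 ≤ f x)
    (hX : AEMeasurable X P) (hXm : ∀ ω, X ω ∈ unitCube d)
    (hW : HasLaw W (μ.prod (Measure.pi fun _ : Fin n => boostingLaw)) P) (hind : IndepFun X W P)
    {xlow y : Vec d} (hxlow : xlow ∈ unitCube d) (hy : y ∈ unitCube d) (j : Fin n) :
    Integrable (fun ω => inner ℝ
      (-((3 / 8 : ℝ) • o (queryPoint xlow (X ω) ((W ω).2 j)) (W ω).1)) (X ω - y)) P ∧
    ∫ ω, ((1 - supNorm xlow) / 4 * f y - f ((1 / 2 : ℝ) • (X ω + xlow))) ∂P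
      ≤ ∫ ω, inner ℝ (-((3 / 8 : ℝ) • o (queryPoint xlow (X ω) ((W ω).2 j)) (W ω).1))
        (X ω - y) ∂P := by
  obtain ⟨hm, hlaw⟩ := map_prodMk_sample hX hW hind j
  obtain ⟨c, hc⟩ := exists_norm_sub_le_of_mem_unitCube y
  set Φ : Vec d × (Ξ × ℝ) → ℝ := fun p =>
    inner ℝ ((3 / 8 : ℝ) • o (queryPoint xlow p.1 p.2.2) p.2.1) (y - p.1) with hΦ
  have hΦm : Measurable Φ := by
    have := ho.measurable_query xlow
    exact (this.const_smul (3 / 8 : ℝ)).inner (measurable_fst.const_sub y)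
  have heq : (fun ω => inner ℝ
      (-((3 / 8 : ℝ) • o (queryPoint xlow (X ω) ((W ω).2 j)) (W ω).1)) (X ω - y))
      = fun ω => Φ (X ω, ((W ω).1, (W ω).2 j)) := by
    ext1 ω
    simp only [hΦ]
    rw [← neg_sub y (X ω), inner_neg_left, inner_neg_right, neg_neg]
  have hint : Integrable (fun ω => Φ (X ω, ((W ω).1, (W ω).2 j))) P := by
    refine .of_bound (hΦm.comp_aemeasurable hm).aestronglyMeasurable (3 / 8 * G * c) ?_
    filter_upwards [ho.ae_sample_norm_le hX hXm hW hind hxlow j] with ω hω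
    refine (norm_inner_le_norm _ _).trans ?_
    rw [norm_smul, norm_sub_rev, Real.norm_of_nonneg (by norm_num)]
    have hG : 0 ≤ G := (norm_nonneg _).trans hω
    exact mul_le_mul (mul_le_mul_of_nonneg_left hω (by norm_num)) (hc _ (hXm ω)) (norm_nonneg _)
      (by positivity)
  rw [heq]
  refine ⟨hint, ?_⟩
  have hint' : Integrable Φ ((P.map X).prod (μ.prod boostingLaw)) := by
    rw [← hlaw]
    exact (integrable_map_measure hΦm.aestronglyMeasurable hm).mpr hint
  -- Conditioning on the decision: by independence the joint law is a product, and the inner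
  -- integral is bounded by the fixed-decision estimate.
  rw [← integral_map hm hΦm.aestronglyMeasurable, hlaw, integral_prod _ hint',
    integral_map hX hint'.integral_prod_left.aestronglyMeasurable]
  refine integral_mono ?_ ?_ fun ω => ho.boosting_bound hf h0 (hXm ω) hy hxlow
  · exact (integrable_const _).sub (hf.continuousOn.integrable_comp_of_mem
      (X := fun ω => (1 / 2 : ℝ) • (X ω + xlow)) (by fun_prop) fun ω => half_add_mem (hXm ω) hxlow)
  · exact (integrable_map_measure hint'.integral_prod_left.aestronglyMeasurable hX).mp
      hint'.integral_prod_left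

end Round

/-! ### Numerical estimates for the block size and the final constant -/

theorem blockSize_le {n : ℕ} {𝒢 : SimpleGraph (Fin n)} {A : Matrix (Fin n) (Fin n) ℝ}
    (hA : IsCommunicationMatrix 𝒢 A) (hn : 2 ≤ n) :
    (blockSize A : ℝ) ≤ 20 * Real.log n / √(spectralGap A) := by
  have hn' : (2 : ℝ) ≤ n := by exact_mod_cast hn
  have hρ0 : 0 < √(spectralGap A) := Real.sqrt_pos.mpr (spectralGap_pos hA)
  have hρ1 : √(spectralGap A) ≤ 1 := Real.sqrt_le_one.mpr (spectralGap_le_one A)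
  have h2 : √2 ^ 2 = (2 : ℝ) := Real.sq_sqrt (by norm_num)
  have h2' : 1.4 < √2 := by rw [Real.lt_sqrt (by norm_num)]; norm_num
  have hlog2 : 0.69 ≤ Real.log n :=
    (by linarith [Real.log_two_gt_d9] : (0.69 : ℝ) ≤ Real.log 2).trans
      (Real.log_le_log (by norm_num) hn')
  have hlog : Real.log √(14 * n) ≤ 5 / 2 * Real.log n := by
    rw [Real.log_sqrt (by positivity)]
    -- For `n ≥ 2`, `n ^ 4 ≥ 16`; this turns `ln √(14 n)` into a multiple of `ln n`.
    have h14 : (14 : ℝ) * n ≤ n ^ 5 := by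
      have : (2 : ℝ) ^ 4 ≤ n ^ 4 := pow_le_pow_left₀ (by norm_num) hn' 4
      nlinarith
    have := Real.log_le_log (by positivity) h14
    rw [Real.log_pow] at this
    push_cast at this
    linarith
  have hlog0 : 0 ≤ Real.log √(14 * n) := by
    apply Real.log_nonneg
    rw [Real.le_sqrt' (by norm_num)]
    linarith
  have h3 : √2 * Real.log √(14 * n) / ((√2 - 1) * √(spectralGap A))
      ≤ 9 * Real.log n / √(spectralGap A) := by
    rw [mul_comm (√2 - 1), ← div_div, div_le_iff₀ (by linarith), div_mul_eq_mul_div]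
    refine div_le_div_of_nonneg_right ?_ hρ0.le
    have h4 : √2 ≤ 3.5 * (√2 - 1) := by linarith
    have h5 : 0 ≤ √2 - 1 := by linarith
    calc √2 * Real.log √(14 * n) ≤ 3.5 * (√2 - 1) * (5 / 2 * Real.log n) := by gcongr
      _ ≤ 9 * Real.log n * (√2 - 1) := by nlinarith [mul_nonneg h5 (by linarith : 0 ≤ Real.log n)]
  have h6 : (blockSize A : ℝ) ≤ √2 * Real.log √(14 * n) / ((√2 - 1) * √(spectralGap A)) + 1 :=
    (Nat.ceil_lt_add_one (div_nonneg (by positivity)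
      (mul_nonneg (by linarith) hρ0.le))).le
  have h7 : 1 ≤ 11 * Real.log n / √(spectralGap A) := by
    rw [le_div_iff₀ hρ0]
    linarith
  refine h6.trans ((add_le_add h3 h7).trans (le_of_eq ?_))
  rw [← add_div]
  ring

theorem sqrt_blockSize_le {n : ℕ} {𝒢 : SimpleGraph (Fin n)} {A : Matrix (Fin n) (Fin n) ℝ}
    (hA : IsCommunicationMatrix 𝒢 A) (hn : 2 ≤ n) (T : ℕ) :
    √(5 * T * blockSize A)
      ≤ 10 * (spectralGap A ^ (-(1 / 4) : ℝ) * √(T * Real.log n)) := by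
  have hρ := spectralGap_pos hA
  have hlog : 0 ≤ Real.log n := Real.log_natCast_nonneg n
  have hpow : (spectralGap A ^ (-(1 / 4) : ℝ)) ^ 2 = 1 / √(spectralGap A) := by
    rw [← Real.rpow_natCast, ← Real.rpow_mul hρ.le, Real.sqrt_eq_rpow,
      one_div (spectralGap A ^ (1 / 2 : ℝ)),
      ← Real.rpow_neg hρ.le]
    norm_num
  rw [Real.sqrt_le_left (by positivity), mul_pow, mul_pow, hpow, Real.sq_sqrt (by positivity)]
  have h := mul_le_mul_of_nonneg_left (blockSize_le hA hn) (by positivity : 0 ≤ 5 * (T : ℝ))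
  refine h.trans (le_of_eq ?_)
  ring

/-- For this `h` the two terms are `1` and `4/5` times `√(5CT) G R`, and `9/5 ≤ 2`. -/
theorem regret_bound_eq {n C T G R : ℝ} (hC : 0 < C) (hT : 0 < T) (hG : 0 < G) (hR : 0 < R)
    (hn : 0 ≤ n) :
    n * (√(5 * C * T) * G / R * R ^ 2 + 4 * (T * C * G ^ 2) / (√(5 * C * T) * G / R))
      ≤ 2 * n * G * R * √(5 * T * C) := by
  have e : 5 * T * C = 5 * C * T := by ring
  rw [e]
  have hq : 0 < √(5 * C * T) := by positivity
  have hq2 : √(5 * C * T) ^ 2 = 5 * C * T := Real.sq_sqrt (by positivity)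
  have h1 : 4 * (T * C * G ^ 2) / (√(5 * C * T) * G / R) = 4 / 5 * (√(5 * C * T) * G * R) := by
    have : T * C = √(5 * C * T) ^ 2 / 5 := by rw [hq2]; ring
    rw [this]
    field_simp
  have h2 : √(5 * C * T) * G / R * R ^ 2 = √(5 * C * T) * G * R := by
    field_simp
  rw [h1, h2]
  have : 0 ≤ n * (√(5 * C * T) * G * R) := by positivity
  linarith

/-! ### Expected regret -/

section MainBound

variable {n d : ℕ}

theorem approxRegret_eq_sum {K : Set (Vec d)} {f : ℕ → Fin n → Vec d → ℝ} {T : ℕ} {y : Vec d}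
    (hy : y ∈ K) (hmax : IsMaxOn (fun y => ∑ t ∈ Finset.range T, ∑ j, f t j y) K y) (α : ℝ)
    (x : ℕ → Vec d) : approxRegret K f α T x
      = ∑ t ∈ Finset.range T, ∑ j, (α * f t j y - f t j (x t)) := by
  have h : IsGreatest ((fun y => ∑ t ∈ Finset.range T, ∑ j, f t j y) '' K)
      (∑ t ∈ Finset.range T, ∑ j, f t j y) :=
    ⟨⟨y, hy, rfl⟩, by rintro _ ⟨x, hx, rfl⟩; exact hmax hx⟩
  rw [approxRegret, h.csSup_eq]
  simp only [Finset.sum_sub_distrib, Finset.mul_sum]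

theorem regret_integrable_and_le {T : ℕ} {G R : ℝ} (hG : 0 < G)
    {K : Set (Vec d)} (hKc : IsClosed K) (hconv : Convex ℝ K) (hKsub : K ⊆ unitCube d)
    (hKR : ∀ x ∈ K, ‖x‖ ≤ R) {xlow : Vec d} (hxlow : xlow ∈ K)
    {𝒢 : SimpleGraph (Fin n)} {A : Matrix (Fin n) (Fin n) ℝ} (hA : IsCommunicationMatrix 𝒢 A)
    {f : ℕ → Fin n → Vec d → ℝ}
    (hf : ∀ t < T, ∀ i, IsDRSubmodular (f t i) ∧ ∀ x ∈ unitCube d, 0 ≤ f t i x)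
    {Ξ : Type*} [MeasurableSpace Ξ] {μ : ℕ → Measure Ξ} [∀ t, IsProbabilityMeasure (μ t)]
    {o : ℕ → Fin n → Vec d → Ξ → Vec d}
    (ho : ∀ t < T, ∀ i, IsStochasticGradient (μ t) G (f t i) (o t i))
    {Ω : Type*} [MeasurableSpace Ω] {P : Measure Ω} [IsProbabilityMeasure P]
    {W : ℕ → Ω → Ξ × (Fin n → ℝ)}
    (hW : ∀ t < T, HasLaw (W t) ((μ t).prod (Measure.pi fun _ : Fin n => boostingLaw)) P)
    (hind : iIndepFun (fun t : Fin T => W t) P) {h : ℝ} (hh : 0 < h) (i : Fin n) :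
    Integrable (fun ω => approxRegret K f ((1 - supNorm xlow) / 4) T (fun t =>
      played (ADFTRL K A (blockSize A) (mixingRatio A) h) xlow o (fun s => W s ω) t i)) P ∧
    ∫ ω, approxRegret K f ((1 - supNorm xlow) / 4) T (fun t =>
      played (ADFTRL K A (blockSize A) (mixingRatio A) h) xlow o (fun s => W s ω) t i) ∂P
      ≤ n * (h * R ^ 2 + 4 * (T * blockSize A * G ^ 2) / h) := by
  have hK : IsCompact K := isCompact_unitCube.of_isClosed_subset hKc hKsub
  have hne : K.Nonempty := ⟨xlow, hxlow⟩
  have hxl := hKsub hxlow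
  -- The rewards are fixed in advance, so one deterministic maximizer serves as comparator for all
  -- `ω`.
  obtain ⟨y, hy, hmax⟩ := hK.exists_isMaxOn hne
    (f := fun y => ∑ t ∈ Finset.range T, ∑ j, f t j y)
    (continuousOn_finsetSum _ fun t ht => continuousOn_finsetSum _ fun j _ =>
      (hf t (Finset.mem_range.mp ht) j).1.continuousOn.mono hKsub)
  simp only [approxRegret_eq_sum hy hmax]
  set α := (1 - supNorm xlow) / 4 with hα
  set D := ADFTRL K A (blockSize A) (mixingRatio A) h with hD
  set X : ℕ → Fin n → Ω → Vec d := fun t j ω =>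
    D.decision (reductionState D xlow o (fun s => W s ω) t) j with hXdef
  have hXrun : ∀ t j ω, X t j ω = (adftrlRun K A (blockSize A) (mixingRatio A) h
      (lossGrad D xlow o fun s => W s ω) t).x j := by
    intro t j ω
    simp only [hXdef, hD]
    rw [reductionState_eq_adftrlRun]
    rfl
  have hXK : ∀ t j ω, X t j ω ∈ K := fun t j ω => by
    rw [hXrun]; exact adftrlRun_mem A _ _ h hK hne _ t j
  have hXc : ∀ t j ω, X t j ω ∈ unitCube d := fun t j ω => hKsub (hXK t j ω)
  have : Nonempty Ω := P.nonempty_of_neZero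
  have hXm : ∀ t < T, ∀ j, AEMeasurable (X t j) P ∧ IndepFun (X t j) (W t) P := fun t ht j =>
    indepFun_history (fun t ht => (hW t ht).aemeasurable) hind ht
      (Φ := fun w => D.decision (reductionState D xlow o w t) j)
      ((measurableState_reductionState A _ _ hK hne hconv hh xlow o
        (fun t ht j => (ho t ht j).measurable) t ht.le).x j)
      (fun w w' hw => by rw [reductionState_congr D xlow o t hw])
  have hplayed : ∀ ω t, played D xlow o (fun s => W s ω) t i
      = (1 / 2 : ℝ) • (X t i ω + xlow) := fun ω t => rfl
  simp only [hplayed]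
  have hfint : ∀ t < T, ∀ j k,
      Integrable (fun ω => f t j ((1 / 2 : ℝ) • (X t k ω + xlow))) P := by
    intro t ht j k
    have := (hXm t ht k).1
    exact (hf t ht j).1.continuousOn.integrable_comp_of_mem
      (X := fun ω => (1 / 2 : ℝ) • (X t k ω + xlow)) (by fun_prop)
      fun ω => half_add_mem (hXc t k ω) hxl
  have hgap : ∀ t ∈ Finset.range T, ∀ j ∈ Finset.univ,
      Integrable (fun ω => α * f t j y - f t j ((1 / 2 : ℝ) • (X t i ω + xlow))) P :=
    fun t ht j _ => (integrable_const _).sub (hfint t (Finset.mem_range.mp ht) j i)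
  refine ⟨integrable_finsetSum _ fun t ht => integrable_finsetSum _ (hgap t ht), ?_⟩
  set g : ℕ → Fin n → Ω → Vec d := fun t j ω => lossGrad D xlow o (fun s => W s ω) t j with hg
  have hround : ∀ t < T, ∀ j,
      Integrable (fun ω => inner ℝ (g t j ω) (X t j ω - y)) P ∧
      ∫ ω, (α * f t j y - f t j ((1 / 2 : ℝ) • (X t j ω + xlow))) ∂P
        ≤ ∫ ω, inner ℝ (g t j ω) (X t j ω - y) ∂P := fun t ht j =>
    (ho t ht j).integral_sample_le (hf t ht j).1 (hf t ht j).2 (hXm t ht j).1 (hXc t j) (hW t ht)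
      (hXm t ht j).2 hxl (hKsub hy) j
  have hdist : ∀ t < T, ∀ j, Integrable (fun ω => G / 2 * ‖X t j ω - X t i ω‖) P := by
    intro t ht j
    refine Integrable.const_mul (.of_bound
      ((hXm t ht j).1.sub (hXm t ht i).1).norm.aestronglyMeasurable (R + R)
      (.of_forall fun ω => ?_)) _
    rw [norm_norm]
    exact (norm_sub_le _ _).trans (add_le_add (hKR _ (hXK t j ω)) (hKR _ (hXK t i ω)))
  have hB : ∀ t ∈ Finset.range T, ∀ j ∈ Finset.univ,
      Integrable (fun ω => inner ℝ (g t j ω) (X t j ω - y) + G / 2 * ‖X t j ω - X t i ω‖) P :=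
    fun t ht j _ => (hround t (Finset.mem_range.mp ht) j).1.add
      (hdist t (Finset.mem_range.mp ht) j)
  -- The loss of learner `j` controls `f t j` at the point played by `j`. Passing to the point
  -- played by `i` uses the Lipschitz constant `G`, halved because the played points are midpoints
  -- with `xlow`.
  have hstep : ∀ t ∈ Finset.range T, ∀ j ∈ Finset.univ,
      ∫ ω, (α * f t j y - f t j ((1 / 2 : ℝ) • (X t i ω + xlow))) ∂P
        ≤ ∫ ω, (inner ℝ (g t j ω) (X t j ω - y) + G / 2 * ‖X t j ω - X t i ω‖) ∂P := by
    intro t ht j hj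
    have ht' := Finset.mem_range.mp ht
    have hgj : Integrable (fun ω => α * f t j y - f t j ((1 / 2 : ℝ) • (X t j ω + xlow))) P :=
      (integrable_const _).sub (hfint t ht' j j)
    rw [integral_add (hround t ht' j).1 (hdist t ht' j)]
    refine le_trans ?_ (add_le_add_left (hround t ht' j).2 _)
    rw [← integral_add hgj (hdist t ht' j)]
    refine integral_mono (hgap t ht j hj) (hgj.add (hdist t ht' j)) fun ω => ?_
    have h1 := (ho t ht' j).lipschitz (half_add_mem (hXc t j ω) hxl) (half_add_mem (hXc t i ω) hxl)
    have h2 : (1 / 2 : ℝ) • (X t j ω + xlow) - (1 / 2 : ℝ) • (X t i ω + xlow)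
        = (1 / 2 : ℝ) • (X t j ω - X t i ω) := by module
    rw [h2, norm_smul, Real.norm_of_nonneg (by norm_num)] at h1
    dsimp only
    linarith
  -- The losses are in fact bounded by `3G/8`; `G` is used so that `Γ = G` also covers the
  -- disagreement penalty `G / 2`.
  have hbound : ∀ᵐ ω ∂P, ∀ t < T, ∀ j, ‖g t j ω‖ ≤ G := by
    rw [ae_all_iff]
    intro t
    by_cases ht : t < T
    · simp only [ht, forall_const]
      rw [ae_all_iff]
      intro j
      filter_upwards [(ho t ht j).ae_sample_norm_le (hXm t ht j).1 (hXc t j) (hW t ht)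
        (hXm t ht j).2 hxl j] with ω hω
      have h1 : ‖g t j ω‖
          = 3 / 8 * ‖o t j (queryPoint xlow (X t j ω) ((W t ω).2 j)) (W t ω).1‖ := by
        simp only [hg, lossGrad, norm_neg, norm_smul, hXdef]
        norm_num
      rw [h1]
      linarith
    · exact .of_forall fun ω h => absurd h ht
  calc _ = ∑ t ∈ Finset.range T, ∑ j,
        ∫ ω, (α * f t j y - f t j ((1 / 2 : ℝ) • (X t i ω + xlow))) ∂P := by
        rw [integral_finsetSum _ fun t ht => integrable_finsetSum _ (hgap t ht)]
        exact Finset.sum_congr rfl fun t ht => integral_finsetSum _ (hgap t ht)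
    _ ≤ ∑ t ∈ Finset.range T, ∑ j,
        ∫ ω, (inner ℝ (g t j ω) (X t j ω - y) + G / 2 * ‖X t j ω - X t i ω‖) ∂P :=
        Finset.sum_le_sum fun t ht => Finset.sum_le_sum (hstep t ht)
    _ = ∫ ω, ∑ t ∈ Finset.range T, ∑ j,
        (inner ℝ (g t j ω) (X t j ω - y) + G / 2 * ‖X t j ω - X t i ω‖) ∂P := by
        rw [integral_finsetSum _ fun t ht => integrable_finsetSum _ (hB t ht)]
        exact Finset.sum_congr rfl fun t ht => (integral_finsetSum _ (hB t ht)).symm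
    _ ≤ ∫ _ω, n * (h * R ^ 2 + 4 * (T * blockSize A * G ^ 2) / h) ∂P := by
        refine integral_mono_ae
          (integrable_finsetSum _ fun t ht => integrable_finsetSum _ (hB t ht))
          (integrable_const _) ?_
        filter_upwards [hbound] with ω hω
        simp only [hXrun]
        exact adftrlRun_regret hA hK hconv hh hG.le hKR (fun t j => g t j ω) hω hy i
    _ = _ := by simp

end MainBound

theorem corollary1 :
    ∃ c : ℝ, 0 < c ∧
      ∀ (n d T : ℕ) (G R : ℝ), 0 < T → 0 < G → 0 < R →
      -- the decision set `K ⊆ [0,1]^d` and a minimizer `xlow` of `‖·‖_∞` over it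
      ∀ (K : Set (Vec d)), IsClosed K → Convex ℝ K → K ⊆ unitCube d → (∀ x ∈ K, ‖x‖ ≤ R) →
      ∀ (xlow : Vec d), xlow ∈ K → IsMinOn supNorm K xlow →
      -- the communication network
      ∀ (𝒢 : SimpleGraph (Fin n)) (A : Matrix (Fin n) (Fin n) ℝ), IsCommunicationMatrix 𝒢 A →
      -- the reward functions, fixed in advance
      ∀ (f : ℕ → Fin n → Vec d → ℝ),
      (∀ t < T, ∀ i, IsDRSubmodular (f t i) ∧ ∀ x ∈ unitCube d, 0 ≤ f t i x) →
      -- the stochastic gradient oracles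
      ∀ (Ξ : Type*) [MeasurableSpace Ξ] (μ : ℕ → Measure Ξ) [∀ t, IsProbabilityMeasure (μ t)]
        (o : ℕ → Fin n → Vec d → Ξ → Vec d),
      (∀ t < T, ∀ i, IsStochasticGradient (μ t) G (f t i) (o t i)) →
      -- the randomness: independent over the rounds, and at each round the samples of the
      -- learners are independent, with law `𝒵`, and independent of the noise of the oracles
      ∀ (Ω : Type*) [MeasurableSpace Ω] (P : Measure Ω) [IsProbabilityMeasure P]
        (W : ℕ → Ω → Ξ × (Fin n → ℝ)),
      (∀ t < T, HasLaw (W t) ((μ t).prod (Measure.pi fun _ : Fin n => boostingLaw)) P) →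
      iIndepFun (fun t : Fin T => W t) P →
      ∀ i : Fin n,
        let C := blockSize A
        let D := ADFTRL K A C (mixingRatio A) (√(5 * C * T) * G / R)
        let regret : Ω → ℝ := fun ω =>
          approxRegret K f ((1 - supNorm xlow) / 4) T
            (fun t => played D xlow o (fun s => W s ω) t i)
        Integrable regret P ∧
        ∫ ω, regret ω ∂P ≤ 2 * n * G * R * √(5 * T * C) ∧
        (2 ≤ n → ∫ ω, regret ω ∂P ≤
          c * (n * G * R * spectralGap A ^ (-(1 / 4) : ℝ) * √(T * Real.log n))) := by
  -- The factor `2` of the main bound times the `10` of `sqrt_blockSize_le`.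
  refine ⟨20, by norm_num, ?_⟩
  intro n d T G R hT hG hR K hKc hconv hKsub hKR xlow hxlow _ 𝒢 A hA f hf Ξ _ μ _ o ho Ω _ P _ W
    hW hind i
  have hC : (0 : ℝ) < blockSize A := by exact_mod_cast blockSize_pos hA i.pos
  have hT' : (0 : ℝ) < T := by exact_mod_cast hT
  have hh : 0 < √(5 * blockSize A * T) * G / R := by positivity
  obtain ⟨hint, hle⟩ := regret_integrable_and_le hG hKc hconv hKsub hKR hxlow hA hf ho hW
    hind hh i
  have hmain := hle.trans (regret_bound_eq hC hT' hG hR (Nat.cast_nonneg n))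
  refine ⟨hint, hmain, fun hn => hmain.trans ?_⟩
  have h := mul_le_mul_of_nonneg_left (sqrt_blockSize_le hA hn T)
    (by positivity : 0 ≤ 2 * n * G * R)
  refine h.trans (le_of_eq ?_)
  ring
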